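/- Let $d$ be a squarefree (in particular non-zero) integer, and let $E^d$ be the elliptic curve $y^2 = x^3 - 11d^2x + 14d^3$ over $\mathbb{Q}$. Fix an algebraic closure $\overline{\mathbb{Q}}$ of $\mathbb{Q}$, and for $n \ge 1$ let $\mathbb{Q}(E^d[n]) \subset \overline{\mathbb{Q}}$ be the $n$-division field, generated over $\mathbb{Q}$ by the coordinates of all the affine points $P \in E^d(\overline{\mathbb{Q}})$ with $nP = O$. Let $$f_4(x) = x^8 - 4x^6 + 8x^4 - 4x^2 + 1$$ and $$\begin{aligned} f_8(x) ={}& x^{32} + 16x^{31} + 120x^{30} + 560x^{29} + 1848x^{28} + 4784x^{27} + 11000x^{26} + 25344x^{25} + 59844x^{24}\\ &+ 133856x^{23} + 260768x^{22} + 419392x^{21} + 534920x^{20} + 513536x^{19} + 332032x^{18} + 93856x^{17}\\ &- 43548x^{16} - 22112x^{15} + 61056x^{14} + 77728x^{13} + 20768x^{12} - 18304x^{11} + 320x^{10} + 21440x^{9}\\ &+ 8240x^{8} - 8256x^{7} - 1888x^{6} + 3584x^{5} + 800x^{4} - 1216x^{3} + 320x^{2} + 8. \end{aligned}$$ Then: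 1. $\mathbb{Q}(E^d[2]) = \mathbb{Q}(\sqrt{2})$. 2. For every root $\alpha \in \overline{\mathbb{Q}}$ of $f_4$, $[\mathbb{Q}(\alpha):\mathbb{Q}] = 8$ and $\mathbb{Q}(E^d[4]) = \mathbb{Q}(\alpha, \sqrt{d})$. 3. For every root $\beta \in \overline{\mathbb{Q}}$ of $f_8$, $[\mathbb{Q}(\beta):\mathbb{Q}] = 32$ and $\mathbb{Q}(E^d[8]) = \mathbb{Q}(\beta, \sqrt{d})$. In particular, $[\mathbb{Q}(E^d[2]):\mathbb{Q}] = 2$; $[\mathbb{Q}(E^d[4]):\mathbb{Q}] = 8$ if and only if $d \in \{\pm 1, \pm 2\}$; and $[\mathbb{Q}(E^d[8]):\mathbb{Q}] = 32$ if and only if $d \in \{\pm 1, \pm 2\}$. If $d \notin \{\pm 1, \pm 2\}$, then $[\mathbb{Q}(E^d[4]):\mathbb{Q}] = 16$ and $[\mathbb{Q}(E^d[8]):\mathbb{Q}] = 64$. -/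

import Mathlib

open Polynomial

open Classical in
/-- The `n`-division field `F(E[n])` of a Weierstrass curve `E` over `F`: the subfield of an
algebraic closure of `F` generated over `F` by the coordinates of all the affine points `P` of `E`
over that closure with `n • P = 0`. -/
noncomputable def divisionField {F : Type*} [Field F] (E : WeierstrassCurve F) (n : ℕ) :
    IntermediateField F (AlgebraicClosure F) :=
  IntermediateField.adjoin F
    {z | ∃ (x y : AlgebraicClosure F)
      (h : (E.baseChange (AlgebraicClosure F)).toAffine.Nonsingular x y),
      n • WeierstrassCurve.Affine.Point.some x y h = 0 ∧ (z = x ∨ z = y)}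

/-- The curve `y ^ 2 = x ^ 3 - 11 d ^ 2 x + 14 d ^ 3` over `ℚ`. -/
def twistCurve (d : ℤ) : WeierstrassCurve ℚ where
  a₁ := 0
  a₂ := 0
  a₃ := 0
  a₄ := -11 * (d : ℚ) ^ 2
  a₆ := 14 * (d : ℚ) ^ 3

/-- The octic polynomial that defines the `4`-division field for `d = 1`. -/
noncomputable def polyFour : ℚ[X] :=
  X ^ 8 - 4 * X ^ 6 + 8 * X ^ 4 - 4 * X ^ 2 + 1

/-- The polynomial of degree `32` that defines the `8`-division field for `d = 1`. -/
noncomputable def polyEight : ℚ[X] :=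
  X ^ 32 + 16 * X ^ 31 + 120 * X ^ 30 + 560 * X ^ 29 + 1848 * X ^ 28 + 4784 * X ^ 27
    + 11000 * X ^ 26 + 25344 * X ^ 25 + 59844 * X ^ 24 + 133856 * X ^ 23 + 260768 * X ^ 22
    + 419392 * X ^ 21 + 534920 * X ^ 20 + 513536 * X ^ 19 + 332032 * X ^ 18 + 93856 * X ^ 17
    - 43548 * X ^ 16 - 22112 * X ^ 15 + 61056 * X ^ 14 + 77728 * X ^ 13 + 20768 * X ^ 12
    - 18304 * X ^ 11 + 320 * X ^ 10 + 21440 * X ^ 9 + 8240 * X ^ 8 - 8256 * X ^ 7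
    - 1888 * X ^ 6 + 3584 * X ^ 5 + 800 * X ^ 4 - 1216 * X ^ 3 + 320 * X ^ 2 + 8

/-! A point `(X, Y)` of `y ^ 2 = (x - e₁) (x - e₂) (x - e₃)` is halved by adjoining the square
roots of the `X - eⱼ`. Here the `eⱼ` are `2d` and `d (-1 ± 2√2)`, and halving generators of the
`2`-torsion once and twice gives `ℚ(E[4]) = ℚ(i, 2^(1/4), √d)` and
`ℚ(E[8]) = ℚ(i, 2^(1/8), ζ₁₆, √d)`. The roots of `f₄` and `f₈` are primitive elements of
`ℚ(i, 2^(1/4))` and `ℚ(i, 2^(1/8), ζ₁₆)`. A rational number that is a square in the latter field is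
a square in `ℚ(i, √2)` already, so it is `±1` or `±2` up to rational squares; hence `√d` doubles the
degree unless `d ∈ {±1, ±2}`. -/

section QuadraticExtension

open IntermediateField

variable {F L : Type*} [Field F] [Field L] [Algebra F L] {K : IntermediateField F L} {r x : L}

theorem mem_sup_adjoin_self (K : IntermediateField F L) (r : L) : r ∈ K ⊔ F⟮r⟯ :=
  (le_sup_right : F⟮r⟯ ≤ K ⊔ F⟮r⟯) (mem_adjoin_simple_self F r)

theorem mem_sup_adjoin_of_mem (hx : x ∈ K) (r : L) : x ∈ K ⊔ F⟮r⟯ :=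
  (le_sup_left : K ≤ K ⊔ F⟮r⟯) hx

theorem mem_of_sq_eq_sq (hx : x ∈ K) (h : r ^ 2 = x ^ 2) : r ∈ K := by
  rcases sq_eq_sq_iff_eq_or_eq_neg.1 h with rfl | rfl
  exacts [hx, neg_mem hx]

theorem aeval_X_sq_sub_C_eq_zero (hr : r ^ 2 ∈ K) :
    aeval r (X ^ 2 - C (⟨r ^ 2, hr⟩ : K)) = 0 := by
  rw [map_sub, map_pow, aeval_X, aeval_C, sub_eq_zero]
  rfl

theorem isIntegral_of_sq_mem (hr : r ^ 2 ∈ K) : IsIntegral K r :=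
  ⟨_, monic_X_pow_sub_C _ two_ne_zero, aeval_X_sq_sub_C_eq_zero hr⟩

theorem mem_sup_adjoin_sqrt_iff (hr : r ^ 2 ∈ K) :
    x ∈ K ⊔ F⟮r⟯ ↔ ∃ a ∈ K, ∃ b ∈ K, x = a + b * r := by
  constructor
  · intro hx
    rw [← restrictScalars_adjoin_eq_sup, mem_restrictScalars, ← mem_toSubalgebra,
      adjoin_simple_toSubalgebra_of_isAlgebraic (isIntegral_of_sq_mem hr).isAlgebraic,
      Algebra.adjoin_singleton_eq_range_aeval] at hx
    obtain ⟨p, rfl⟩ := hx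
    have hmonic : (X ^ 2 - C (⟨r ^ 2, hr⟩ : K)).Monic := monic_X_pow_sub_C _ two_ne_zero
    obtain ⟨b, a, hab⟩ := exists_eq_X_add_C_of_natDegree_le_one
      (Nat.le_of_lt_succ ((natDegree_modByMonic_lt p hmonic
        (fun h ↦ by simpa using congrArg natDegree h)).trans_eq natDegree_X_pow_sub_C))
    refine ⟨a, a.2, b, b.2, ?_⟩
    rw [AlgHom.toRingHom_eq_coe, RingHom.coe_coe,
      ← aeval_modByMonic_eq_self_of_root (aeval_X_sq_sub_C_eq_zero hr), hab]
    simp [add_comm]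
  · rintro ⟨a, ha, b, hb, rfl⟩
    exact add_mem (mem_sup_adjoin_of_mem ha r)
      (mul_mem (mem_sup_adjoin_of_mem hb r) (mem_sup_adjoin_self K r))

theorem coeff_eq_of_notMem (hr : r ∉ K) {a b a' b' : L} (ha : a ∈ K) (hb : b ∈ K) (ha' : a' ∈ K)
    (hb' : b' ∈ K) (h : a + b * r = a' + b' * r) : a = a' ∧ b = b' := by
  have hbb' : b = b' := by
    by_contra hne
    refine hr ?_
    rw [show r = (a' - a) / (b - b') by
      rw [eq_div_iff (sub_ne_zero.2 hne)]
      linear_combination h]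
    exact div_mem (sub_mem ha' ha) (sub_mem hb hb')
  subst hbb'
  exact ⟨add_right_cancel h, rfl⟩

theorem finrank_sup_adjoin_sqrt (hr : r ^ 2 ∈ K) (hrK : r ∉ K) :
    Module.finrank F ↥(K ⊔ F⟮r⟯) = 2 * Module.finrank F K := by
  have hirr : Irreducible (X ^ 2 - C (⟨r ^ 2, hr⟩ : K)) := by
    refine X_pow_sub_C_irreducible_of_prime Nat.prime_two fun b hb ↦ hrK ?_
    exact mem_of_sq_eq_sq b.2 (congrArg Subtype.val hb).symm
  have hdeg : Module.finrank K K⟮r⟯ = 2 := by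
    rw [adjoin.finrank (isIntegral_of_sq_mem hr), ← minpoly.eq_of_irreducible_of_monic hirr
      (aeval_X_sq_sub_C_eq_zero hr) (monic_X_pow_sub_C _ two_ne_zero), natDegree_X_pow_sub_C]
  rw [← restrictScalars_adjoin_eq_sup, mul_comm, ← hdeg]
  exact (Module.finrank_mul_finrank F K K⟮r⟯).symm

theorem finrank_sup_adjoin_sqrt_eq_iff [FiniteDimensional F K] (hr : r ^ 2 ∈ K) :
    Module.finrank F ↥(K ⊔ F⟮r⟯) = Module.finrank F K ↔ r ∈ K := by
  refine ⟨fun h ↦ ?_, fun h ↦ by rw [sup_eq_left.2 (adjoin_simple_le_iff.2 h)]⟩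
  by_contra hrK
  have hpos : 0 < Module.finrank F K := Module.finrank_pos
  have := finrank_sup_adjoin_sqrt hr hrK
  omega

theorem sqrt_mem_or_mem_mul [NeZero (2 : L)] (hr : r ^ 2 ∈ K) (hx : x ∈ K ⊔ F⟮r⟯)
    (hx2 : x ^ 2 ∈ K) : x ∈ K ∨ ∃ q ∈ K, x = q * r := by
  by_cases hrK : r ∈ K
  · rw [sup_eq_left.2 (adjoin_simple_le_iff.2 hrK)] at hx
    exact Or.inl hx
  obtain ⟨a, ha, b, hb, rfl⟩ := (mem_sup_adjoin_sqrt_iff hr).1 hx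
  have hab : 2 * a * b = 0 := (coeff_eq_of_notMem hrK
    (add_mem (pow_mem ha 2) (mul_mem (pow_mem hb 2) hr))
    (mul_mem (mul_mem (ofNat_mem K 2) ha) hb) hx2 (zero_mem K) (by ring)).2
  rcases mul_eq_zero.1 hab with h | rfl
  · obtain rfl := (mul_eq_zero.1 h).resolve_left two_ne_zero
    exact Or.inr ⟨b, hb, zero_add _⟩
  · exact Or.inl (by simpa using ha)

variable {i v : L}

-- Comparing coefficients, `(a + b r)² = c r` forces `a² + b² r² = 0`, that is, `a = ± i b r`.
theorem sq_ne_mul_of_sqrt_neg_one_mem (hi : i ^ 2 = -1) (hiK : i ∈ K) (hr : r ^ 2 ∈ K)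
    (hrK : r ∉ K) {c : L} (hc : c ∈ K) (hc0 : c ≠ 0) (hx : x ∈ K ⊔ F⟮r⟯) : x ^ 2 ≠ c * r := by
  obtain ⟨a, ha, b, hb, rfl⟩ := (mem_sup_adjoin_sqrt_iff hr).1 hx
  intro h
  obtain ⟨hsq, hab⟩ := coeff_eq_of_notMem hrK
    (add_mem (pow_mem ha 2) (mul_mem (pow_mem hb 2) hr))
    (mul_mem (mul_mem (ofNat_mem K 2) ha) hb) (zero_mem K) hc
    (show a ^ 2 + b ^ 2 * r ^ 2 + 2 * a * b * r = 0 + c * r by linear_combination h)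
  have hb0 : b ≠ 0 := by
    rintro rfl
    exact hc0 (by rw [← hab, mul_zero])
  have hir : i * r ∈ K := by
    have hbr : (b * (i * r)) ^ 2 = a ^ 2 := by linear_combination b ^ 2 * r ^ 2 * hi - hsq
    simpa [hb0] using div_mem (mem_of_sq_eq_sq ha hbr) hb
  refine hrK ?_
  rw [show r = -(i * (i * r)) by linear_combination r * hi]
  exact neg_mem (mul_mem hiK hir)

theorem sup_adjoin_pow_sup_adjoin (K : IntermediateField F L) (v : L) (m : ℕ) :
    K ⊔ F⟮v ^ m⟯ ⊔ F⟮v⟯ = K ⊔ F⟮v⟯ := by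
  rw [sup_assoc, sup_eq_right.2 (adjoin_simple_le_iff.2 (pow_mem (mem_adjoin_simple_self F v) m))]

theorem sup_adjoin_pow_le (K : IntermediateField F L) (v : L) (m : ℕ) :
    K ⊔ F⟮v ^ m⟯ ≤ K ⊔ F⟮v⟯ :=
  sup_le_sup_left (adjoin_simple_le_iff.2 (pow_mem (mem_adjoin_simple_self F v) m)) K

theorem pow_notMem_sup_adjoin (hi : i ^ 2 = -1) (hiK : i ∈ K) {n : ℕ}
    (hv : v ^ 2 ^ (n + 2) ∈ K) (hvK : v ^ 2 ^ (n + 1) ∉ K) :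
    v ^ 2 ^ n ∉ K ⊔ F⟮v ^ 2 ^ (n + 1)⟯ := by
  intro hmem
  refine sq_ne_mul_of_sqrt_neg_one_mem hi hiK ?_ hvK (one_mem K) one_ne_zero hmem ?_
  · rwa [← pow_mul, ← pow_succ]
  · rw [← pow_mul, ← pow_succ, one_mul]

theorem finrank_sup_adjoin_of_pow_two_pow_mem (hi : i ^ 2 = -1) (hiK : i ∈ K) {n : ℕ}
    (hv : v ^ 2 ^ (n + 1) ∈ K) (hvK : v ^ 2 ^ n ∉ K) :
    Module.finrank F ↥(K ⊔ F⟮v⟯) = 2 ^ (n + 1) * Module.finrank F K := by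
  induction n generalizing K with
  | zero =>
    rw [zero_add, pow_one] at hv ⊢
    exact finrank_sup_adjoin_sqrt hv (by simpa using hvK)
  | succ n ih =>
    have hsq : (v ^ 2 ^ (n + 1)) ^ 2 ∈ K := by rwa [← pow_mul, ← pow_succ]
    rw [← sup_adjoin_pow_sup_adjoin K v (2 ^ (n + 1)), ih (mem_sup_adjoin_of_mem hiK _)
      (mem_sup_adjoin_self K _) (pow_notMem_sup_adjoin hi hiK hv hvK),
      finrank_sup_adjoin_sqrt hsq hvK]
    ring

theorem mem_sup_adjoin_pow_of_sq_mem [NeZero (2 : L)] (hi : i ^ 2 = -1) (hiK : i ∈ K) {n : ℕ}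
    (hv : v ^ 2 ^ (n + 1) ∈ K) (hvK : v ^ 2 ^ n ∉ K) (hx : x ∈ K ⊔ F⟮v⟯) (hx2 : x ^ 2 ∈ K) :
    x ∈ K ⊔ F⟮v ^ 2 ^ n⟯ := by
  induction n generalizing K with
  | zero => simpa using hx
  | succ n ih =>
    set ρ := v ^ 2 ^ (n + 1) with hρ
    have hρ2 : ρ ^ 2 ∈ K := by rwa [hρ, ← pow_mul, ← pow_succ]
    have hvρ : (v ^ 2 ^ n) ^ 2 = ρ := by rw [hρ, ← pow_mul, ← pow_succ]
    rw [← sup_adjoin_pow_sup_adjoin K v (2 ^ (n + 1))] at hx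
    have hx' := ih (mem_sup_adjoin_of_mem hiK _) (mem_sup_adjoin_self K _)
      (pow_notMem_sup_adjoin hi hiK hv hvK) hx (mem_sup_adjoin_of_mem hx2 _)
    rcases sqrt_mem_or_mem_mul (hvρ ▸ mem_sup_adjoin_self K _) hx'
      (mem_sup_adjoin_of_mem hx2 _) with h | ⟨q, hq, rfl⟩
    · exact h
    · by_cases hx0 : q * v ^ 2 ^ n = 0
      · exact hx0 ▸ zero_mem _
      have hρ0 : ρ ≠ 0 := fun h ↦ hvK (h ▸ zero_mem K)
      refine absurd ?_ (sq_ne_mul_of_sqrt_neg_one_mem hi hiK hρ2 hvK (div_mem hx2 hρ2)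
        (div_ne_zero (pow_ne_zero 2 hx0) (pow_ne_zero 2 hρ0)) hq)
      rw [mul_pow, hvρ]
      field_simp

end QuadraticExtension

section RationalSquares

theorem eq_zero_of_sq_eq_two_mul_sq {a b : ℚ} (h : a ^ 2 = 2 * b ^ 2) : b = 0 := by
  by_contra hb
  have hsq : IsSquare (2 : ℚ) := ⟨a / b, by field_simp; linarith⟩
  exact Nat.prime_two.prime.irreducible.not_isSquare (Rat.isSquare_ofNat_iff.1 hsq)

theorem dvd_of_squarefree_of_isSquare_mul {d e : ℤ} (hd : Squarefree d) (h : IsSquare (d * e)) :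
    d ∣ e := by
  obtain ⟨m, hm⟩ := h
  have hdm : d ∣ m := (hd.dvd_pow_iff_dvd two_ne_zero).1 ⟨e, by rw [hm, sq]⟩
  exact (mul_dvd_mul_iff_left hd.ne_zero).1 (hm ▸ mul_dvd_mul hdm hdm)

theorem eq_of_squarefree_of_isSquare_mul {d e : ℤ} (hd : Squarefree d) (he : Squarefree e)
    (h : IsSquare (d * e)) : d = e := by
  rcases Int.associated_iff.1 (associated_of_dvd_dvd (dvd_of_squarefree_of_isSquare_mul hd h)
    (dvd_of_squarefree_of_isSquare_mul he (mul_comm d e ▸ h))) with rfl | rfl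
  · rfl
  · have := h.nonneg
    exact absurd (by nlinarith) he.ne_zero

theorem eq_of_squarefree_of_eq_mul_sq {d e : ℤ} (hd : Squarefree d) (he : Squarefree e) {c : ℚ}
    (h : (d : ℚ) = e * c ^ 2) : d = e := by
  refine eq_of_squarefree_of_isSquare_mul hd he (Rat.isSquare_intCast_iff.1 ⟨e * c, ?_⟩)
  push_cast
  rw [h]
  ring

theorem mem_pm_one_pm_two_of_eq_mul_sq {d e : ℤ} (hd : Squarefree d)
    (he : e ∈ ({1, -1, 2, -2} : Set ℤ)) {c : ℚ} (h : (d : ℚ) = e * c ^ 2) :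
    d ∈ ({1, -1, 2, -2} : Set ℤ) := by
  have hsf : Squarefree e := by
    rcases he with rfl | rfl | rfl | rfl
    exacts [squarefree_one, isUnit_neg_one.squarefree, Int.prime_two.squarefree,
      Int.prime_two.neg.squarefree]
  rwa [eq_of_squarefree_of_eq_mul_sq hd hsf h]

end RationalSquares

section GaussianNumbers

open IntermediateField SubfieldClass

variable {L : Type*} [Field L] [CharZero L] {i x : L}

theorem exists_ratCast_of_mem_bot (hx : x ∈ (⊥ : IntermediateField ℚ L)) : ∃ a : ℚ, x = a := by
  obtain ⟨a, rfl⟩ := mem_bot.1 hx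
  exact ⟨a, eq_ratCast _ a⟩

theorem sqrt_neg_one_sq_mem_bot (hi : i ^ 2 = -1) : i ^ 2 ∈ (⊥ : IntermediateField ℚ L) :=
  hi ▸ neg_mem (one_mem _)

theorem sqrt_neg_one_notMem_bot (hi : i ^ 2 = -1) : i ∉ (⊥ : IntermediateField ℚ L) := by
  intro h
  obtain ⟨a, rfl⟩ := exists_ratCast_of_mem_bot h
  have ha : a ^ 2 = -1 := by exact_mod_cast hi
  nlinarith [sq_nonneg a]

theorem finrank_adjoin_sqrt_neg_one (hi : i ^ 2 = -1) : Module.finrank ℚ ℚ⟮i⟯ = 2 := by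
  rw [← bot_sup_eq ℚ⟮i⟯, finrank_sup_adjoin_sqrt (sqrt_neg_one_sq_mem_bot hi)
    (sqrt_neg_one_notMem_bot hi), IntermediateField.finrank_bot, mul_one]

theorem exists_of_mem_adjoin_sqrt_neg_one (hi : i ^ 2 = -1) (hx : x ∈ ℚ⟮i⟯) :
    ∃ a b : ℚ, x = a + b * i := by
  rw [← bot_sup_eq ℚ⟮i⟯, mem_sup_adjoin_sqrt_iff (sqrt_neg_one_sq_mem_bot hi)] at hx
  obtain ⟨a, ha, b, hb, rfl⟩ := hx
  obtain ⟨a, rfl⟩ := exists_ratCast_of_mem_bot ha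
  obtain ⟨b, rfl⟩ := exists_ratCast_of_mem_bot hb
  exact ⟨a, b, rfl⟩

theorem ratCast_coeff_eq (hi : i ^ 2 = -1) {a b a' b' : ℚ}
    (h : (a : L) + b * i = a' + b' * i) : a = a' ∧ b = b' := by
  exact_mod_cast coeff_eq_of_notMem (sqrt_neg_one_notMem_bot hi) (ratCast_mem _ a)
    (ratCast_mem _ b) (ratCast_mem _ a') (ratCast_mem _ b') h

theorem exists_ratCast_of_sq_eq_ratCast (hi : i ^ 2 = -1) (hx : x ∈ ℚ⟮i⟯) {c : ℚ}
    (hc : x ^ 2 = c) : ∃ a : ℚ, c = a ^ 2 ∨ c = -a ^ 2 := by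
  rw [← bot_sup_eq ℚ⟮i⟯] at hx
  rcases sqrt_mem_or_mem_mul (sqrt_neg_one_sq_mem_bot hi) hx (hc ▸ ratCast_mem _ c)
    with h | ⟨q, hq, rfl⟩
  · obtain ⟨a, rfl⟩ := exists_ratCast_of_mem_bot h
    exact ⟨a, Or.inl (by exact_mod_cast hc.symm)⟩
  · obtain ⟨a, rfl⟩ := exists_ratCast_of_mem_bot hq
    have h : (c : L) = -a ^ 2 := by linear_combination -hc + a ^ 2 * hi
    exact ⟨a, Or.inr (by exact_mod_cast h)⟩

theorem sqrt_two_notMem_adjoin_sqrt_neg_one (hi : i ^ 2 = -1) {w : L} (hw : w ^ 2 = 2) :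
    w ∉ ℚ⟮i⟯ := by
  intro h
  obtain ⟨a, ha | ha⟩ := exists_ratCast_of_sq_eq_ratCast (c := 2) hi h (by exact_mod_cast hw)
  · exact one_ne_zero (eq_zero_of_sq_eq_two_mul_sq (a := a) (b := 1) (by linarith))
  · nlinarith [sq_nonneg a]

-- Taking norms to `ℚ`, the square of a rational would be `2 * d ^ 2`.
theorem eq_zero_of_sq_eq_mul_one_add_sqrt_neg_one (hi : i ^ 2 = -1) (hx : x ∈ ℚ⟮i⟯) {d : ℚ}
    (h : x ^ 2 = d * (1 + i)) : d = 0 := by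
  obtain ⟨a, b, rfl⟩ := exists_of_mem_adjoin_sqrt_neg_one hi hx
  obtain ⟨hre, him⟩ := ratCast_coeff_eq hi (a := a ^ 2 - b ^ 2) (b := 2 * a * b) (a' := d) (b' := d)
    (by
      push_cast
      linear_combination h - (b : L) ^ 2 * hi)
  refine eq_zero_of_sq_eq_two_mul_sq (a := a ^ 2 + b ^ 2) ?_
  linear_combination (a ^ 2 - b ^ 2 + d) * hre + (2 * a * b + d) * him

end GaussianNumbers

section Tower

open IntermediateField SubfieldClass

variable {L : Type*} [Field L] [CharZero L] {i v u ζ x s : L}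

theorem pow_two_pow_notMem_adjoin_sqrt_neg_one (hi : i ^ 2 = -1) {n : ℕ}
    (hv : v ^ 2 ^ (n + 1) = 2) : v ^ 2 ^ n ∉ ℚ⟮i⟯ :=
  sqrt_two_notMem_adjoin_sqrt_neg_one hi (by rwa [← pow_mul, ← pow_succ])

theorem finrank_adjoin_sqrt_neg_one_sup_adjoin (hi : i ^ 2 = -1) {n : ℕ}
    (hv : v ^ 2 ^ (n + 1) = 2) : Module.finrank ℚ ↥(ℚ⟮i⟯ ⊔ ℚ⟮v⟯) = 2 ^ (n + 2) := by
  rw [finrank_sup_adjoin_of_pow_two_pow_mem hi (mem_adjoin_simple_self ℚ i)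
    (hv ▸ ofNat_mem _ 2) (pow_two_pow_notMem_adjoin_sqrt_neg_one hi hv),
    finrank_adjoin_sqrt_neg_one hi, ← pow_succ]

theorem eighthRoot_pow_four_notMem (hi : i ^ 2 = -1) (hu : u ^ 8 = 2) : u ^ 4 ∉ ℚ⟮i⟯ :=
  pow_two_pow_notMem_adjoin_sqrt_neg_one (n := 2) hi hu

theorem eighthRoot_pow_four_sq_mem (hu : u ^ 8 = 2) : (u ^ 4) ^ 2 ∈ ℚ⟮i⟯ := by
  rw [← pow_mul, hu]
  exact ofNat_mem _ 2

theorem eighthRoot_sq_notMem (hi : i ^ 2 = -1) (hu : u ^ 8 = 2) : u ^ 2 ∉ ℚ⟮i⟯ ⊔ ℚ⟮u ^ 4⟯ :=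
  pow_notMem_sup_adjoin (n := 1) hi (mem_adjoin_simple_self ℚ i) (hu ▸ ofNat_mem _ 2)
    (eighthRoot_pow_four_notMem hi hu)

theorem mem_sup_adjoin_eighthRoot_sq_of_sq_mem (hi : i ^ 2 = -1) (hu : u ^ 8 = 2)
    (hx : x ∈ ℚ⟮i⟯ ⊔ ℚ⟮u⟯) (hx2 : x ^ 2 ∈ ℚ⟮i⟯ ⊔ ℚ⟮u ^ 4⟯) :
    x ∈ ℚ⟮i⟯ ⊔ ℚ⟮u ^ 4⟯ ⊔ ℚ⟮u ^ 2⟯ := by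
  rw [← sup_adjoin_pow_sup_adjoin _ u 4] at hx
  exact mem_sup_adjoin_pow_of_sq_mem (n := 1) hi
    (mem_sup_adjoin_of_mem (mem_adjoin_simple_self ℚ i) _) (mem_sup_adjoin_self _ _)
    (eighthRoot_sq_notMem hi hu) hx hx2

theorem eq_zero_of_sq_eq_mul_one_add_sqrt_neg_one_of_mem_sup (hi : i ^ 2 = -1) {w : L}
    (hw : w ^ 2 = 2) (hx : x ∈ ℚ⟮i⟯ ⊔ ℚ⟮w⟯) {d : ℚ} (h : x ^ 2 = d * (1 + i)) : d = 0 := by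
  have hiK := mem_adjoin_simple_self ℚ i
  rcases sqrt_mem_or_mem_mul (hw ▸ ofNat_mem _ 2) hx
    (h ▸ mul_mem (ratCast_mem _ d) (add_mem (one_mem _) hiK)) with hx | ⟨q, hq, rfl⟩
  · exact eq_zero_of_sq_eq_mul_one_add_sqrt_neg_one hi hx h
  · have h' : (2 * q) ^ 2 = (2 * d : ℚ) * (1 + i) := by
      push_cast
      linear_combination 2 * h - 2 * q ^ 2 * hw
    have := eq_zero_of_sq_eq_mul_one_add_sqrt_neg_one hi (mul_mem (ofNat_mem _ 2) hq) h'
    linarith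

theorem eq_zero_of_sq_eq_mul_one_add_sqrt_neg_one_mul (hi : i ^ 2 = -1) (hu : u ^ 8 = 2)
    (hx : x ∈ ℚ⟮i⟯ ⊔ ℚ⟮u⟯) {d : ℚ} (h : x ^ 2 = d * (1 + i) * u ^ 4) : d = 0 := by
  have hiK := mem_adjoin_simple_self ℚ i
  have hw : (u ^ 4) ^ 2 = 2 := by rw [← pow_mul, hu]
  have hc : d * (1 + i) ∈ ℚ⟮i⟯ := mul_mem (ratCast_mem _ d) (add_mem (one_mem _) hiK)
  have hx2 : x ^ 2 ∈ ℚ⟮i⟯ ⊔ ℚ⟮u ^ 4⟯ :=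
    h ▸ mul_mem (mem_sup_adjoin_of_mem hc _) (mem_sup_adjoin_self _ _)
  have hx' := mem_sup_adjoin_eighthRoot_sq_of_sq_mem hi hu hx hx2
  have ht : (u ^ 2) ^ 2 ∈ ℚ⟮i⟯ ⊔ ℚ⟮u ^ 4⟯ := by
    rw [← pow_mul]
    exact mem_sup_adjoin_self _ _
  rcases sqrt_mem_or_mem_mul ht hx' hx2 with hx | ⟨q, hq, rfl⟩
  · by_contra hd
    have hi1 : 1 + i ≠ 0 := fun h0 ↦ two_ne_zero (α := L) (by linear_combination (1 - i) * h0 + hi)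
    exact sq_ne_mul_of_sqrt_neg_one_mem hi hiK (eighthRoot_pow_four_sq_mem hu)
      (eighthRoot_pow_four_notMem hi hu) hc (mul_ne_zero (Rat.cast_ne_zero.2 hd) hi1) hx h
  · refine eq_zero_of_sq_eq_mul_one_add_sqrt_neg_one_of_mem_sup hi hw hq ?_
    have hu0 : u ^ 4 ≠ 0 := fun h0 ↦ eighthRoot_pow_four_notMem hi hu (h0 ▸ zero_mem _)
    refine mul_right_cancel₀ hu0 ?_
    linear_combination h

theorem zeta_pow_four (hi : i ^ 2 = -1) (hu : u ^ 8 = 2) (hζ : 2 * ζ ^ 2 = (1 + i) * u ^ 4) :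
    ζ ^ 4 = i := by
  refine mul_left_cancel₀ (show (4 : L) ≠ 0 by norm_num) ?_
  linear_combination (2 * ζ ^ 2 + (1 + i) * u ^ 4) * hζ + (1 + i) ^ 2 * hu + 2 * hi

theorem zeta_sq_mem (hζ : 2 * ζ ^ 2 = (1 + i) * u ^ 4) : ζ ^ 2 ∈ ℚ⟮i⟯ ⊔ ℚ⟮u ^ 4⟯ := by
  rw [show ζ ^ 2 = (1 + i) * u ^ 4 / 2 by rw [← hζ]; ring]
  have hiK := mem_adjoin_simple_self ℚ i
  exact div_mem (mul_mem (mem_sup_adjoin_of_mem (add_mem (one_mem _) hiK) _)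
    (mem_sup_adjoin_self _ _)) (ofNat_mem _ 2)

theorem zeta_notMem (hi : i ^ 2 = -1) (hu : u ^ 8 = 2) (hζ : 2 * ζ ^ 2 = (1 + i) * u ^ 4) :
    ζ ∉ ℚ⟮i⟯ ⊔ ℚ⟮u⟯ := by
  intro h
  have := eq_zero_of_sq_eq_mul_one_add_sqrt_neg_one_mul (d := 2⁻¹) hi hu h (by
    push_cast
    linear_combination hζ / 2)
  norm_num at this

theorem finrank_sup_adjoin_zeta (hi : i ^ 2 = -1) (hu : u ^ 8 = 2)
    (hζ : 2 * ζ ^ 2 = (1 + i) * u ^ 4) :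
    Module.finrank ℚ ↥(ℚ⟮i⟯ ⊔ ℚ⟮u⟯ ⊔ ℚ⟮ζ⟯) = 32 := by
  rw [finrank_sup_adjoin_sqrt (sup_adjoin_pow_le _ u 4 (zeta_sq_mem hζ)) (zeta_notMem hi hu hζ),
    finrank_adjoin_sqrt_neg_one_sup_adjoin (n := 2) hi hu]
  norm_num

theorem mem_sup_adjoin_eighthRoot_pow_four_of_sq_eq_ratCast (hi : i ^ 2 = -1) (hu : u ^ 8 = 2)
    (hζ : 2 * ζ ^ 2 = (1 + i) * u ^ 4) (hs : s ∈ ℚ⟮i⟯ ⊔ ℚ⟮u⟯ ⊔ ℚ⟮ζ⟯) {d : ℚ} (h : s ^ 2 = d) :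
    s ∈ ℚ⟮i⟯ ⊔ ℚ⟮u ^ 4⟯ := by
  have hζ2 := sup_adjoin_pow_le _ u 4 (zeta_sq_mem hζ)
  rcases sqrt_mem_or_mem_mul hζ2 hs (h ▸ ratCast_mem _ d) with hs | ⟨q, hq, rfl⟩
  · exact mem_sup_adjoin_pow_of_sq_mem (n := 2) hi (mem_adjoin_simple_self ℚ i)
      (hu ▸ ofNat_mem _ 2) (eighthRoot_pow_four_notMem hi hu) hs (h ▸ ratCast_mem _ d)
  · have hd : d = 0 := by
      have hmem : (1 + i) * u ^ 4 * q ∈ ℚ⟮i⟯ ⊔ ℚ⟮u⟯ :=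
        mul_mem (hζ ▸ mul_mem (ofNat_mem _ 2) hζ2) hq
      have := eq_zero_of_sq_eq_mul_one_add_sqrt_neg_one_mul (d := 2 * d) hi hu hmem (by
        push_cast
        linear_combination 2 * (1 + i) * u ^ 4 * h - (1 + i) * u ^ 4 * q ^ 2 * hζ)
      linarith
    rw [hd, Rat.cast_zero] at h
    rw [pow_eq_zero_iff two_ne_zero |>.1 h]
    exact zero_mem _

theorem mem_pm_one_pm_two_of_sqrt_mem (hi : i ^ 2 = -1) (hu : u ^ 8 = 2)
    (hζ : 2 * ζ ^ 2 = (1 + i) * u ^ 4) {d : ℤ} (hd : Squarefree d) (h : s ^ 2 = d)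
    (hs : s ∈ ℚ⟮i⟯ ⊔ ℚ⟮u⟯ ⊔ ℚ⟮ζ⟯) : d ∈ ({1, -1, 2, -2} : Set ℤ) := by
  have hsd : s ^ 2 = (d : ℚ) := by exact_mod_cast h
  have hs' := mem_sup_adjoin_eighthRoot_pow_four_of_sq_eq_ratCast hi hu hζ hs hsd
  rcases sqrt_mem_or_mem_mul (eighthRoot_pow_four_sq_mem hu) hs' (hsd ▸ ratCast_mem _ _)
    with hs | ⟨q, hq, rfl⟩
  · obtain ⟨a, ha | ha⟩ := exists_ratCast_of_sq_eq_ratCast hi hs hsd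
    · exact mem_pm_one_pm_two_of_eq_mul_sq hd (e := 1) (by simp) (by simpa using ha)
    · exact mem_pm_one_pm_two_of_eq_mul_sq hd (e := -1) (by simp) (by simpa using ha)
  · obtain ⟨a, ha | ha⟩ := exists_ratCast_of_sq_eq_ratCast hi hq (c := d / 2) (by
      push_cast
      linear_combination h / 2 - q ^ 2 / 2 * hu)
    · exact mem_pm_one_pm_two_of_eq_mul_sq hd (e := 2) (c := a) (by simp)
        (by push_cast; linarith)
    · exact mem_pm_one_pm_two_of_eq_mul_sq hd (e := -2) (c := a) (by simp)
        (by push_cast; linarith)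

theorem sqrt_mem_of_mem_pm_one_pm_two (hi : i ^ 2 = -1) {w : L} (hw : w ^ 2 = 2) {d : ℤ}
    (hd : d ∈ ({1, -1, 2, -2} : Set ℤ)) (hs : s ^ 2 = d) : s ∈ ℚ⟮i⟯ ⊔ ℚ⟮w⟯ := by
  have hiK : i ∈ ℚ⟮i⟯ ⊔ ℚ⟮w⟯ := mem_sup_adjoin_of_mem (mem_adjoin_simple_self ℚ i) w
  have hwK : w ∈ ℚ⟮i⟯ ⊔ ℚ⟮w⟯ := mem_sup_adjoin_self _ w
  obtain ⟨a, haK, ha⟩ : ∃ a ∈ ℚ⟮i⟯ ⊔ ℚ⟮w⟯, s ^ 2 = a ^ 2 := by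
    rcases hd with rfl | rfl | rfl | rfl
    · exact ⟨1, one_mem _, by simp [hs]⟩
    · exact ⟨i, hiK, by simp [hs, hi]⟩
    · exact ⟨w, hwK, by simp [hs, hw]⟩
    · exact ⟨i * w, mul_mem hiK hwK, by simp [hs, mul_pow, hi, hw]⟩
  exact mem_of_sq_eq_sq haK ha

end Tower

section PrimitiveElements

open IntermediateField

variable {F L : Type*} [Field F] [Field L] [Algebra F L] {K : IntermediateField F L}
  {p : F[X]} {a x y : L}

theorem isPrimitiveRoot_two_pow_of_pow_eq_neg_one [CharZero L] {n : ℕ} (h : x ^ 2 ^ n = -1) :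
    IsPrimitiveRoot x (2 ^ (n + 1)) := by
  refine IsPrimitiveRoot.iff_orderOf.2 (orderOf_eq_prime_pow ?_ ?_)
  · rw [h]
    norm_num
  · rw [pow_succ, pow_mul, h, neg_one_sq]

theorem mem_of_pow_eq_pow {ε : L} {n : ℕ} [NeZero n] (hε : IsPrimitiveRoot ε n) (hεK : ε ∈ K)
    (ha : a ∈ K) (h : x ^ n = a ^ n) : x ∈ K := by
  by_cases ha0 : a = 0
  · rw [ha0, zero_pow (NeZero.ne n)] at h
    exact pow_eq_zero_iff (NeZero.ne n) |>.1 h ▸ zero_mem K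
  · obtain ⟨k, -, hk⟩ := hε.eq_pow_of_pow_eq_one
      (show (x / a) ^ n = 1 by rw [div_pow, h, div_self (pow_ne_zero n ha0)])
    rw [(div_eq_iff ha0).1 hk.symm]
    exact mul_mem (pow_mem hεK k) ha

theorem eq_adjoin_simple_of_aeval_eq_zero (hp : p.Monic) (hx : aeval x p = 0) (hK : K ≤ F⟮x⟯)
    (hn : Module.finrank F K = p.natDegree) : K = F⟮x⟯ := by
  have hint : IsIntegral F x := ⟨p, hp, by rwa [← aeval_def]⟩
  have := adjoin.finiteDimensional hint
  refine eq_of_le_of_finrank_le hK ?_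
  rw [hn, adjoin.finrank hint]
  exact natDegree_le_of_dvd (minpoly.dvd F x hx) hp.ne_zero

theorem isConjRoot_of_natDegree_eq_finrank (hp : p.Monic)
    (hn : p.natDegree = Module.finrank F F⟮x⟯) (hx : aeval x p = 0) (hy : aeval y p = 0) :
    IsConjRoot F x y := by
  have hint : IsIntegral F x := ⟨p, hp, by rwa [← aeval_def]⟩
  refine isConjRoot_of_aeval_eq_zero hint ?_
  rwa [← eq_of_monic_of_dvd_of_natDegree_le (minpoly.monic hint) hp (minpoly.dvd F x hx)
    (by rw [hn, adjoin.finrank hint])]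

theorem mem_adjoin_simple_of_forall_algEquiv [IsGalois F L]
    (h : ∀ σ : Gal(L/F), σ x = x → σ y = y) : y ∈ F⟮x⟯ := by
  rw [← InfiniteGalois.fixedField_fixingSubgroup F⟮x⟯, mem_fixedField_iff]
  exact fun σ hσ ↦ h σ ((mem_fixingSubgroup_iff _ _).1 hσ _ (mem_adjoin_simple_self F x))

theorem adjoin_simple_eq_of_isConjRoot [Normal F L] (h : IsConjRoot F x y)
    (hx : ∀ σ : Gal(L/F), σ x ∈ F⟮x⟯) : F⟮y⟯ = F⟮x⟯ := by
  have hint (z : L) : IsIntegral F z := Normal.isIntegral ‹_› z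
  have := adjoin.finiteDimensional (hint x)
  obtain ⟨σ, rfl⟩ := isConjRoot_iff_exists_algEquiv.1 h.symm
  refine eq_of_le_of_finrank_eq (adjoin_simple_le_iff.2 (hx σ)) ?_
  rw [adjoin.finrank (hint _), adjoin.finrank (hint _), h]

end PrimitiveElements

section PolyFour

open IntermediateField SubfieldClass

theorem natDegree_polyFour : polyFour.natDegree = 8 := by
  unfold polyFour
  compute_degree!

theorem monic_polyFour : polyFour.Monic := by
  unfold polyFour
  monicity!

variable {L : Type*} [Field L] [CharZero L] {i t α : L}

theorem aeval_polyFour (α : L) :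
    aeval α polyFour = (α ^ 2 - 1) ^ 4 + 2 * α ^ 4 := by
  simp only [polyFour, map_add, map_sub, map_mul, map_pow, map_one, map_ofNat, aeval_X]
  ring

-- Take `θ = (α² - 1) / α`, so that `α` is a root of `X² - θ X - 1`. Its discriminant `θ² + 4` is
-- `-((1 + θ²) θ)²` because `θ⁴ = -2`.
theorem exists_of_aeval_polyFour_eq_zero (hα : aeval α polyFour = 0) :
    ∃ j ∈ ℚ⟮α⟯, ∃ θ ∈ ℚ⟮α⟯, j ^ 2 = -1 ∧ θ ^ 4 = -2 := by
  have hαK := mem_adjoin_simple_self ℚ α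
  rw [aeval_polyFour] at hα
  have hα0 : α ≠ 0 := by
    rintro rfl
    norm_num at hα
  set θ := (α ^ 2 - 1) / α with hθ
  have hαθ : α ^ 2 = θ * α + 1 := by
    rw [hθ, div_mul_cancel₀ _ hα0]
    ring
  have hθK : θ ∈ ℚ⟮α⟯ := div_mem (sub_mem (pow_mem hαK 2) (one_mem _)) hαK
  have hθ4 : θ ^ 4 = -2 := by
    refine mul_right_cancel₀ (pow_ne_zero 4 hα0) ?_
    rw [hθ, div_pow, div_mul_cancel₀ _ (pow_ne_zero 4 hα0)]
    linear_combination hα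
  have hθ0 : (1 + θ ^ 2) * θ ≠ 0 := by
    intro h
    refine OfNat.ofNat_ne_zero (R := L) 6 ?_
    linear_combination (θ ^ 5 - θ ^ 3) * h - (θ ^ 4 - 3) * hθ4
  refine ⟨(2 * α - θ) / ((1 + θ ^ 2) * θ), ?_, θ, hθK, ?_, hθ4⟩
  · exact div_mem (sub_mem (mul_mem (ofNat_mem _ 2) hαK) hθK)
      (mul_mem (add_mem (one_mem _) (pow_mem hθK 2)) hθK)
  · rw [div_pow, div_eq_iff (pow_ne_zero 2 hθ0)]
    linear_combination 4 * hαθ + (θ ^ 2 + 2) * hθ4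

theorem adjoin_eq_of_aeval_polyFour_eq_zero (hi : i ^ 2 = -1) (ht : t ^ 4 = 2)
    (hα : aeval α polyFour = 0) : ℚ⟮i⟯ ⊔ ℚ⟮t⟯ = ℚ⟮α⟯ := by
  refine eq_adjoin_simple_of_aeval_eq_zero monic_polyFour hα ?_ ?_
  · obtain ⟨j, hjK, θ, hθK, hj, hθ⟩ := exists_of_aeval_polyFour_eq_zero hα
    have hiK : i ∈ ℚ⟮α⟯ := mem_of_sq_eq_sq hjK (hi.trans hj.symm)
    refine sup_le (adjoin_simple_le_iff.2 hiK) (adjoin_simple_le_iff.2 ?_)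
    refine mem_of_pow_eq_pow (isPrimitiveRoot_two_pow_of_pow_eq_neg_one (n := 1) hi) hiK
      (show (1 + i) * θ ^ 3 / 2 ∈ ℚ⟮α⟯ from div_mem (mul_mem (add_mem (one_mem _) hiK)
        (pow_mem hθK 3)) (ofNat_mem _ 2)) ?_
    linear_combination ht - (i ^ 2 + 4 * i + 5) * θ ^ 12 / 16 * hi
      + (θ ^ 8 - 2 * θ ^ 4 + 4) / 4 * hθ
  · rw [natDegree_polyFour, finrank_adjoin_sqrt_neg_one_sup_adjoin (n := 1) hi ht]
    rfl

end PolyFour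

section PolyEight

open IntermediateField SubfieldClass

theorem natDegree_polyEight : polyEight.natDegree = 32 := by
  unfold polyEight
  compute_degree!

theorem monic_polyEight : polyEight.Monic := by
  unfold polyEight
  monicity!

section Norms

variable {R : Type*} [CommRing R] {i β y z ζ : R}

-- The left-hand side of the conclusion is the product of `a + z b` and its conjugate `a - z b`.
theorem norm_eq_zero_of_add_mul_eq_zero {a₀ a₁ b₀ b₁ : R} (hi : i ^ 2 = -1) (hz : z ^ 2 = i)
    (h : (a₀ + i * a₁) + z * (b₀ + i * b₁) = 0) :
    (a₀ ^ 2 - a₁ ^ 2 + 2 * b₀ * b₁) + i * (2 * a₀ * a₁ - b₀ ^ 2 + b₁ ^ 2) = 0 := by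
  linear_combination (a₀ + i * a₁ - z * (b₀ + i * b₁)) * h + (b₀ + i * b₁) ^ 2 * hz
    + (i * b₁ ^ 2 + 2 * b₀ * b₁ - a₁ ^ 2) * hi

theorem octic_of_quartic (hy : y ^ 4 = -1) (hζ : ζ ^ 2 = y)
    (h : β ^ 4 + (2 - 2 * y) * β ^ 3 + (1 + y ^ 2) * β ^ 2 + (2 * y - 2 * y ^ 2) * β - 1 + y
      + ζ * ((2 * y ^ 3 - 2 * y) * β ^ 3 + (3 - 3 * y + 3 * y ^ 2 + 3 * y ^ 3) * β ^ 2
        + (2 - 2 * y) * β - y ^ 2 + y ^ 3) = 0) :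
    (β ^ 8 + 4 * β ^ 7 + 6 * β ^ 6 + 4 * β ^ 5 + 6 * β ^ 4 + 4 * β ^ 3 + 6 * β ^ 2 + 8 * β + 1
      + y ^ 2 * (6 * β ^ 6 + 24 * β ^ 5 + 30 * β ^ 4 + 12 * β ^ 3 + 10 * β ^ 2 + 8 * β - 1))
    + y * (-4 * β ^ 7 - 16 * β ^ 6 - 24 * β ^ 5 - 16 * β ^ 4 - 16 * β ^ 3 - 14 * β ^ 2 - 8 * β - 1
      + y ^ 2 * (-4 * β ^ 5 - 18 * β ^ 4 - 16 * β ^ 3 + 2 * β ^ 2 + 1)) = 0 := by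
  set a := β ^ 4 + (2 - 2 * y) * β ^ 3 + (1 + y ^ 2) * β ^ 2 + (2 * y - 2 * y ^ 2) * β - 1 + y
    with ha
  set b := (2 * y ^ 3 - 2 * y) * β ^ 3 + (3 - 3 * y + 3 * y ^ 2 + 3 * y ^ 3) * β ^ 2
    + (2 - 2 * y) * β - y ^ 2 + y ^ 3 with hb
  have hab : a ^ 2 - y * b ^ 2 = 0 := by linear_combination (a - ζ * b) * h + b ^ 2 * hζ
  rw [ha, hb] at hab
  linear_combination hab
    - ((-4 * β ^ 6 - 12 * β ^ 5 - 9 * β ^ 4 - 4 * β ^ 3 - 6 * β ^ 2 - 1) * y ^ 3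
    + (-12 * β ^ 5 - 18 * β ^ 4 + 4 * β ^ 3 + 2) * y ^ 2
    + (8 * β ^ 6 + 24 * β ^ 5 + 17 * β ^ 4 + 16 * β ^ 3 + 12 * β ^ 2 + 4 * β - 1) * y
    - 7 * β ^ 4 - 8 * β ^ 3 - 8 * β ^ 2 - 8 * β) * hy

theorem sq_add_sq_eq_zero_of_add_mul_eq_zero {a b : R} (hi : i ^ 2 = -1) (h : a + i * b = 0) :
    a ^ 2 + b ^ 2 = 0 := by
  linear_combination (a - i * b) * h + b ^ 2 * hi

end Norms

variable {L : Type*} [Field L] [CharZero L] {u y ζ β : L}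

theorem aeval_polyEight_eq_zero_of_octic (hy : y ^ 4 = -1)
    (h : (β ^ 8 + 4 * β ^ 7 + 6 * β ^ 6 + 4 * β ^ 5 + 6 * β ^ 4 + 4 * β ^ 3 + 6 * β ^ 2 + 8 * β + 1
      + y ^ 2 * (6 * β ^ 6 + 24 * β ^ 5 + 30 * β ^ 4 + 12 * β ^ 3 + 10 * β ^ 2 + 8 * β - 1))
    + y * (-4 * β ^ 7 - 16 * β ^ 6 - 24 * β ^ 5 - 16 * β ^ 4 - 16 * β ^ 3 - 14 * β ^ 2 - 8 * β - 1
      + y ^ 2 * (-4 * β ^ 5 - 18 * β ^ 4 - 16 * β ^ 3 + 2 * β ^ 2 + 1)) = 0) :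
    aeval β polyEight = 0 := by
  have hi : (y ^ 2) ^ 2 = -1 := by rw [← pow_mul, hy]
  simp only [polyEight, map_add, map_sub, map_mul, map_pow, map_ofNat, aeval_X]
  linear_combination
    sq_add_sq_eq_zero_of_add_mul_eq_zero hi (norm_eq_zero_of_add_mul_eq_zero hi rfl h)

/-- A root of `polyEight` which generates `ℚ(i, u, ζ)`, the `8`-division field for `d = 1`, when
`u ^ 8 = 2` and `ζ` is the primitive sixteenth root of unity with `2 * ζ ^ 2 = (1 + i) * u ^ 4`. -/
def primitiveElement (u ζ : L) : L :=
  (ζ ^ 2 + ζ * (u ^ 2 + u ^ 4) + ζ ^ 2 * u ^ 7 - 1) / 2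

-- Isolating `ζ ^ 2 * u ^ 7`, then `u ^ 2`, and squaring each time leaves an equation over `ℚ(ζ)`.
theorem quartic_primitiveElement (hζ : ζ ^ 8 = -1) (hu : u ^ 4 = ζ ^ 2 - ζ ^ 6)
    (hβ : β = primitiveElement u ζ) :
    β ^ 4 + (2 - 2 * ζ ^ 2) * β ^ 3 + (1 + ζ ^ 4) * β ^ 2 + (2 * ζ ^ 2 - 2 * ζ ^ 4) * β - 1
      + ζ ^ 2 + ζ * ((2 * ζ ^ 6 - 2 * ζ ^ 2) * β ^ 3
        + (3 - 3 * ζ ^ 2 + 3 * ζ ^ 4 + 3 * ζ ^ 6) * β ^ 2 + (2 - 2 * ζ ^ 2) * β - ζ ^ 4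
        + ζ ^ 6) = 0 := by
  set c := 2 * β + 1 - ζ ^ 2 with hc
  have hsum : c - ζ * u ^ 4 - ζ * u ^ 2 = ζ ^ 2 * u ^ 7 := by
    rw [hc, hβ, primitiveElement]
    ring
  have hu8 : u ^ 8 = 2 := by
    linear_combination (u ^ 4 + ζ ^ 2 - ζ ^ 6) * hu + (ζ ^ 4 - 2) * hζ
  have hζu : ζ ^ 2 * u ^ 4 = 1 + ζ ^ 4 := by linear_combination ζ ^ 2 * hu - hζ
  have hsq : c ^ 2 + (1 + ζ ^ 2) ^ 2 - 2 * ζ * u ^ 4 * c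
      = 2 * u ^ 2 * (ζ * c + (1 + ζ ^ 4) * (ζ ^ 2 - 1)) := by
    linear_combination (c - ζ * u ^ 4 - ζ * u ^ 2 + ζ ^ 2 * u ^ 7) * hsum
      + (ζ ^ 4 * u ^ 6 - ζ ^ 2) * hu8 + (2 * u ^ 2 * (ζ ^ 2 - 1) - 1) * hζu
  have hquartic : (c ^ 2 + (1 + ζ ^ 2) ^ 2 - 2 * ζ * u ^ 4 * c) ^ 2
      = 4 * u ^ 4 * (ζ * c + (1 + ζ ^ 4) * (ζ ^ 2 - 1)) ^ 2 := by
    rw [hsq]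
    ring
  rw [hu, hc] at hquartic
  linear_combination hquartic / 16 - (8 * ζ ^ 10 - (16 * β + 16) * ζ ^ 8 - 8 * ζ ^ 7
    + (16 * β ^ 2 + 16 * β + 4) * ζ ^ 6 + (16 * β + 8) * ζ ^ 5 + (32 * β + 12) * ζ ^ 4
    + 16 * β * ζ ^ 3 - (32 * β ^ 2 + 48 * β + 20) * ζ ^ 2 - (48 * β ^ 2 + 32 * β) * ζ
    + 16 * β ^ 2 + 16 * β + 20) / 16 * hζ

theorem aeval_primitiveElement (hζ : ζ ^ 8 = -1) (hu : u ^ 4 = ζ ^ 2 - ζ ^ 6) :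
    aeval (primitiveElement u ζ) polyEight = 0 := by
  have hy : (ζ ^ 2) ^ 4 = -1 := by rw [← pow_mul, hζ]
  have hquartic := quartic_primitiveElement hζ hu rfl
  set β := primitiveElement u ζ
  refine aeval_polyEight_eq_zero_of_octic hy (octic_of_quartic hy rfl ?_)
  linear_combination hquartic

variable {K : IntermediateField ℚ L} {i : L}

theorem primitiveElement_mem (hu : u ∈ K) (hζ : ζ ∈ K) : primitiveElement u ζ ∈ K :=
  div_mem (sub_mem (add_mem (add_mem (pow_mem hζ 2) (mul_mem hζ (add_mem (pow_mem hu 2)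
    (pow_mem hu 4)))) (mul_mem (pow_mem hζ 2) (pow_mem hu 7))) (one_mem K)) (ofNat_mem K 2)

theorem zeta_pow_eight (hi : i ^ 2 = -1) (hu : u ^ 8 = 2) (hζ : 2 * ζ ^ 2 = (1 + i) * u ^ 4) :
    ζ ^ 8 = -1 := by
  rw [show ζ ^ 8 = (ζ ^ 4) ^ 2 by ring, zeta_pow_four hi hu hζ, hi]

theorem eighthRoot_pow_four_eq (hi : i ^ 2 = -1) (hu : u ^ 8 = 2)
    (hζ : 2 * ζ ^ 2 = (1 + i) * u ^ 4) : u ^ 4 = ζ ^ 2 - ζ ^ 6 := by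
  linear_combination (i - 1) / 2 * hζ + u ^ 4 / 2 * hi + ζ ^ 2 * zeta_pow_four hi hu hζ

theorem map_primitiveElement (σ : Gal(L/ℚ)) (u ζ : L) :
    σ (primitiveElement u ζ) = primitiveElement (σ u) (σ ζ) := by
  simp only [primitiveElement, map_add, map_sub, map_mul, map_div₀, map_pow, map_one, map_ofNat]

theorem exists_map_eq_mul (σ : Gal(L/ℚ)) (hu : u ^ 8 = 2) (hζ : ζ ^ 8 = -1) :
    ∃ ω ρ : L, ω ^ 8 = 1 ∧ ρ ^ 8 = 1 ∧ σ u = ω * u ∧ σ ζ = ρ * ζ := by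
  have hu0 : u ≠ 0 := by rintro rfl; norm_num at hu
  have hζ0 : ζ ≠ 0 := by rintro rfl; norm_num at hζ
  refine ⟨σ u / u, σ ζ / ζ, ?_, ?_, (div_mul_cancel₀ _ hu0).symm, (div_mul_cancel₀ _ hζ0).symm⟩
  · rw [div_pow, ← map_pow, hu, map_ofNat, div_self two_ne_zero]
  · rw [div_pow, ← map_pow, hζ, map_neg, map_one, div_self (neg_ne_zero.2 one_ne_zero)]

theorem mem_sup_adjoin_of_pow_eight_eq_one (hi : i ^ 2 = -1) (hu : u ^ 8 = 2)
    (hζ : 2 * ζ ^ 2 = (1 + i) * u ^ 4) {ρ : L} (hρ : ρ ^ 8 = 1) : ρ ∈ ℚ⟮i⟯ ⊔ ℚ⟮u ^ 4⟯ :=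
  mem_of_pow_eq_pow (isPrimitiveRoot_two_pow_of_pow_eq_neg_one (x := ζ ^ 2) (n := 2)
    (by rw [← pow_mul]; exact zeta_pow_eight hi hu hζ)) (zeta_sq_mem hζ) (one_mem _)
    (by rw [one_pow]; exact hρ)

theorem coeff_eq_of_primitiveElement_eq (hi : i ^ 2 = -1) (hu : u ^ 8 = 2)
    (hζ : 2 * ζ ^ 2 = (1 + i) * u ^ 4) {ω ρ : L} (hω : ω ∈ ℚ⟮i⟯ ⊔ ℚ⟮u⟯) (hρ : ρ ∈ ℚ⟮i⟯ ⊔ ℚ⟮u⟯)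
    (h : primitiveElement (ω * u) (ρ * ζ) = primitiveElement u ζ) :
    ρ ^ 2 * ζ ^ 2 * (1 + ω ^ 7 * u ^ 7) = ζ ^ 2 * (1 + u ^ 7) ∧
      ρ * (ω ^ 2 * u ^ 2 + ω ^ 4 * u ^ 4) = u ^ 2 + u ^ 4 := by
  have hζK := sup_adjoin_pow_le ℚ⟮i⟯ u 4 (zeta_sq_mem hζ)
  have huK : u ∈ ℚ⟮i⟯ ⊔ ℚ⟮u⟯ := mem_sup_adjoin_self _ _
  refine coeff_eq_of_notMem (zeta_notMem hi hu hζ) ?_ ?_ ?_ ?_ ?_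
  · exact mul_mem (mul_mem (pow_mem hρ 2) hζK)
      (add_mem (one_mem _) (mul_mem (pow_mem hω 7) (pow_mem huK 7)))
  · exact mul_mem hρ (add_mem (mul_mem (pow_mem hω 2) (pow_mem huK 2))
      (mul_mem (pow_mem hω 4) (pow_mem huK 4)))
  · exact mul_mem hζK (add_mem (one_mem _) (pow_mem huK 7))
  · exact add_mem (pow_mem huK 2) (pow_mem huK 4)
  · simp only [primitiveElement] at h
    linear_combination 2 * h

theorem eq_one_of_primitiveElement_eq (hi : i ^ 2 = -1) (hu : u ^ 8 = 2)
    (hζ : 2 * ζ ^ 2 = (1 + i) * u ^ 4) {ω ρ : L} (hω : ω ^ 8 = 1) (hρ : ρ ^ 8 = 1)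
    (h : primitiveElement (ω * u) (ρ * ζ) = primitiveElement u ζ) : ω = 1 ∧ ρ = 1 := by
  have hωK := mem_sup_adjoin_of_pow_eight_eq_one hi hu hζ hω
  have hρK := mem_sup_adjoin_of_pow_eight_eq_one hi hu hζ hρ
  have hwK : u ^ 4 ∈ ℚ⟮i⟯ ⊔ ℚ⟮u ^ 4⟯ := mem_sup_adjoin_self _ _
  have hle := sup_adjoin_pow_le ℚ⟮i⟯ u 4
  obtain ⟨hone, hzeta⟩ := coeff_eq_of_primitiveElement_eq hi hu hζ (hle hωK) (hle hρK) h
  obtain ⟨hfour, htwo⟩ : ρ * ω ^ 4 * u ^ 4 = u ^ 4 ∧ ρ * ω ^ 2 = 1 :=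
    coeff_eq_of_notMem (eighthRoot_sq_notMem hi hu) (mul_mem (mul_mem hρK (pow_mem hωK 4)) hwK)
      (mul_mem hρK (pow_mem hωK 2)) hwK (one_mem _) (by linear_combination hzeta)
  have hu0 : u ≠ 0 := by rintro rfl; norm_num at hu
  have hζ0 : ζ ≠ 0 := fun h0 ↦ zeta_notMem hi hu hζ (h0 ▸ zero_mem _)
  have hω2 : ω ^ 2 = 1 := by
    refine mul_right_cancel₀ (pow_ne_zero 4 hu0) ?_
    linear_combination hfour - ω ^ 2 * u ^ 4 * htwo
  have hρ1 : ρ = 1 := by linear_combination htwo - ρ * hω2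
  have hω7 : ω ^ 7 = 1 := by
    refine mul_left_cancel₀ (mul_ne_zero (pow_ne_zero 2 hζ0) (pow_ne_zero 7 hu0)) ?_
    rw [hρ1] at hone
    linear_combination hone
  exact ⟨by linear_combination hω - ω * hω7, hρ1⟩

theorem adjoin_primitiveElement [IsGalois ℚ L] (hi : i ^ 2 = -1) (hu : u ^ 8 = 2)
    (hζ : 2 * ζ ^ 2 = (1 + i) * u ^ 4) :
    ℚ⟮primitiveElement u ζ⟯ = ℚ⟮i⟯ ⊔ ℚ⟮u⟯ ⊔ ℚ⟮ζ⟯ := by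
  have hfix (σ : Gal(L/ℚ)) (hσ : σ (primitiveElement u ζ) = primitiveElement u ζ) :
      σ u = u ∧ σ ζ = ζ := by
    obtain ⟨ω, ρ, hω, hρ, hσu, hσζ⟩ := exists_map_eq_mul σ hu (zeta_pow_eight hi hu hζ)
    rw [map_primitiveElement, hσu, hσζ] at hσ
    obtain ⟨rfl, rfl⟩ := eq_one_of_primitiveElement_eq hi hu hζ hω hρ hσ
    exact ⟨by rw [hσu, one_mul], by rw [hσζ, one_mul]⟩
  have huK := mem_adjoin_simple_of_forall_algEquiv fun σ hσ ↦ (hfix σ hσ).1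
  have hζK := mem_adjoin_simple_of_forall_algEquiv fun σ hσ ↦ (hfix σ hσ).2
  refine le_antisymm (adjoin_simple_le_iff.2 (primitiveElement_mem
    (mem_sup_adjoin_of_mem (mem_sup_adjoin_self _ _) _) (mem_sup_adjoin_self _ _))) ?_
  simp only [sup_le_iff, adjoin_simple_le_iff]
  exact ⟨⟨zeta_pow_four hi hu hζ ▸ pow_mem hζK 4, huK⟩, hζK⟩

theorem adjoin_eq_of_aeval_polyEight_eq_zero [IsGalois ℚ L] (hi : i ^ 2 = -1) (hu : u ^ 8 = 2)
    (hζ : 2 * ζ ^ 2 = (1 + i) * u ^ 4) (hβ : aeval β polyEight = 0) :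
    ℚ⟮i⟯ ⊔ ℚ⟮u⟯ ⊔ ℚ⟮ζ⟯ = ℚ⟮β⟯ := by
  have hζ8 := zeta_pow_eight hi hu hζ
  have hroot := aeval_primitiveElement hζ8 (eighthRoot_pow_four_eq hi hu hζ)
  have hadj := adjoin_primitiveElement hi hu hζ
  have hconj := isConjRoot_of_natDegree_eq_finrank monic_polyEight
    (by rw [hadj, natDegree_polyEight, finrank_sup_adjoin_zeta hi hu hζ]) hroot hβ
  rw [← hadj, adjoin_simple_eq_of_isConjRoot hconj fun σ ↦ ?_]
  obtain ⟨ω, ρ, hω, hρ, hσu, hσζ⟩ := exists_map_eq_mul σ hu hζ8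
  have hroots {ρ : L} (h : ρ ^ 8 = 1) : ρ ∈ ℚ⟮i⟯ ⊔ ℚ⟮u⟯ ⊔ ℚ⟮ζ⟯ := mem_sup_adjoin_of_mem
    (sup_adjoin_pow_le _ u 4 (mem_sup_adjoin_of_pow_eight_eq_one hi hu hζ h)) ζ
  rw [map_primitiveElement, hσu, hσζ, hadj]
  exact primitiveElement_mem
    (mul_mem (hroots hω) (mem_sup_adjoin_of_mem (mem_sup_adjoin_self _ _) _))
    (mul_mem (hroots hρ) (mem_sup_adjoin_self _ _))

end PolyEight

section Halving

open IntermediateField WeierstrassCurve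

theorem mem_of_mul_mem {F L : Type*} [Field F] [Field L] [Algebra F L] {K : IntermediateField F L}
    {a b : L} (ha : a ≠ 0) (haK : a ∈ K) (h : a * b ∈ K) : b ∈ K := by
  simpa only [mul_div_cancel_left₀ b ha] using div_mem h haK

/-- `W` is the curve `y ^ 2 = (x - e₁) * (x - e₂) * (x - e₃)` with distinct `e₁`, `e₂`, `e₃`. -/
structure IsSplit {L : Type*} [Field L] (W : Affine L) (e₁ e₂ e₃ : L) : Prop where
  a₁ : W.a₁ = 0
  a₂ : W.a₂ = -(e₁ + e₂ + e₃)
  a₃ : W.a₃ = 0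
  a₄ : W.a₄ = e₁ * e₂ + e₁ * e₃ + e₂ * e₃
  a₆ : W.a₆ = -(e₁ * e₂ * e₃)
  ne₁₂ : e₁ ≠ e₂
  ne₁₃ : e₁ ≠ e₃
  ne₂₃ : e₂ ≠ e₃

/-- `r₁`, `r₂`, `r₃` are square roots of the differences between `X` and `e₁`, `e₂`, `e₃`, with
product `Y`. On the curve `y ^ 2 = (x - e₁) * (x - e₂) * (x - e₃)` the four such triples correspond
to the four halves of the point `(X, Y)`. -/
structure IsHalving {L : Type*} [Field L] (e₁ e₂ e₃ X Y r₁ r₂ r₃ : L) : Prop where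
  sq₁ : r₁ ^ 2 = X - e₁
  sq₂ : r₂ ^ 2 = X - e₂
  sq₃ : r₃ ^ 2 = X - e₃
  mul_eq : r₁ * r₂ * r₃ = Y

theorem IsHalving.eq_sub_sq {L : Type*} [Field L] {e₁ e₂ e₃ X Y r₁ r₂ r₃ : L}
    (hr : IsHalving e₁ e₂ e₃ X Y r₁ r₂ r₃) :
    e₁ = X - r₁ ^ 2 ∧ e₂ = X - r₂ ^ 2 ∧ e₃ = X - r₃ ^ 2 := by
  simp only [hr.sq₁, hr.sq₂, hr.sq₃, sub_sub_cancel, and_self]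

namespace IsSplit

variable {L : Type*} [Field L] {W : Affine L} {e₁ e₂ e₃ X Y r₁ r₂ r₃ : L}

theorem equation_iff (hW : IsSplit W e₁ e₂ e₃) {x y : L} :
    W.Equation x y ↔ y ^ 2 = (x - e₁) * (x - e₂) * (x - e₃) := by
  rw [Affine.equation_iff, hW.a₁, hW.a₂, hW.a₃, hW.a₄, hW.a₆]
  constructor <;> intro h <;> linear_combination h

theorem sum_ne_zero (hW : IsSplit W e₁ e₂ e₃) (hr : IsHalving e₁ e₂ e₃ X Y r₁ r₂ r₃) :
    r₁ + r₂ ≠ 0 ∧ r₁ + r₃ ≠ 0 ∧ r₂ + r₃ ≠ 0 := by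
  refine ⟨fun h ↦ hW.ne₁₂ ?_, fun h ↦ hW.ne₁₃ ?_, fun h ↦ hW.ne₂₃ ?_⟩
  · linear_combination hr.sq₁ - hr.sq₂ - (r₁ - r₂) * h
  · linear_combination hr.sq₁ - hr.sq₃ - (r₁ - r₃) * h
  · linear_combination hr.sq₂ - hr.sq₃ - (r₂ - r₃) * h

theorem sqrt_mem_of_half_mem {F : Type*} [Field F] [Algebra F L] [NeZero (2 : L)]
    (hW : IsSplit W e₁ e₂ e₃) (hr : IsHalving e₁ e₂ e₃ X Y r₁ r₂ r₃) {K : IntermediateField F L}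
    (h₁ : e₁ ∈ K) (h₂ : e₂ ∈ K) (h₃ : e₃ ∈ K) (hx : X + r₁ * r₂ + r₁ * r₃ + r₂ * r₃ ∈ K)
    (hy : (r₁ + r₂) * (r₁ + r₃) * (r₂ + r₃) ∈ K) : r₁ ∈ K ∧ r₂ ∈ K ∧ r₃ ∈ K := by
  obtain ⟨h12, h13, h23⟩ := hW.sum_ne_zero hr
  have hA : (r₁ + r₂) * (r₁ + r₃) ∈ K := by
    convert sub_mem hx h₁ using 1
    linear_combination hr.sq₁
  have hB : (r₁ + r₂) * (r₂ + r₃) ∈ K := by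
    convert sub_mem hx h₂ using 1
    linear_combination hr.sq₂
  have hC : (r₁ + r₃) * (r₂ + r₃) ∈ K := by
    convert sub_mem hx h₃ using 1
    linear_combination hr.sq₃
  have hs₂₃ : r₂ + r₃ ∈ K :=
    mem_of_mul_mem (mul_ne_zero h12 h13) hA (by convert hy using 1)
  have hs₁₂ : r₁ + r₂ ∈ K := mem_of_mul_mem h23 hs₂₃ (mul_comm (r₁ + r₂) _ ▸ hB)
  have hs₁₃ : r₁ + r₃ ∈ K := mem_of_mul_mem h23 hs₂₃ (mul_comm (r₁ + r₃) _ ▸ hC)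
  have h₁K : r₁ ∈ K := by
    refine mem_of_mul_mem two_ne_zero (ofNat_mem K 2) ?_
    convert sub_mem (add_mem hs₁₂ hs₁₃) hs₂₃ using 1
    ring
  exact ⟨h₁K, (add_mem_cancel_left h₁K).1 hs₁₂, (add_mem_cancel_left h₁K).1 hs₁₃⟩

theorem nonsingular [NeZero (2 : L)] (hW : IsSplit W e₁ e₂ e₃) {x y : L}
    (h : y ^ 2 = (x - e₁) * (x - e₂) * (x - e₃)) : W.Nonsingular x y := by
  rw [Affine.nonsingular_iff', hW.equation_iff, hW.a₁, hW.a₂, hW.a₃, hW.a₄]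
  refine ⟨h, ?_⟩
  by_contra! ⟨hx, hy⟩
  obtain rfl : y = 0 := mul_left_cancel₀ two_ne_zero (by linear_combination hy)
  have h12 := sub_ne_zero.2 hW.ne₁₂
  have h13 := sub_ne_zero.2 hW.ne₁₃
  have h23 := sub_ne_zero.2 hW.ne₂₃
  have hroot : (x - e₁ = 0 ∨ x - e₂ = 0) ∨ x - e₃ = 0 := by
    rw [← mul_eq_zero, ← mul_eq_zero]
    linear_combination -h
  simp only [sub_eq_zero] at hroot
  rcases hroot with (rfl | rfl) | rfl
  · exact mul_ne_zero h12 h13 (by linear_combination -hx)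
  · exact mul_ne_zero h12 h23 (by linear_combination hx)
  · exact mul_ne_zero h13 h23 (by linear_combination -hx)

theorem nonsingular_left [NeZero (2 : L)] (hW : IsSplit W e₁ e₂ e₃) : W.Nonsingular e₁ 0 :=
  hW.nonsingular (by ring)

theorem nonsingular_middle [NeZero (2 : L)] (hW : IsSplit W e₁ e₂ e₃) : W.Nonsingular e₂ 0 :=
  hW.nonsingular (by ring)

theorem nonsingular_half [NeZero (2 : L)] (hW : IsSplit W e₁ e₂ e₃)
    (hr : IsHalving e₁ e₂ e₃ X Y r₁ r₂ r₃) :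
    W.Nonsingular (X + r₁ * r₂ + r₁ * r₃ + r₂ * r₃) ((r₁ + r₂) * (r₁ + r₃) * (r₂ + r₃)) := by
  obtain ⟨h₁, h₂, h₃⟩ := hr.eq_sub_sq
  refine hW.nonsingular ?_
  rw [h₁, h₂, h₃]
  ring

variable [DecidableEq L] [NeZero (2 : L)]

theorem two_nsmul_eq_zero_iff (hW : IsSplit W e₁ e₂ e₃) {x y : L} (h : W.Nonsingular x y) :
    2 • Affine.Point.some x y h = 0 ↔ y = 0 := by
  rw [two_nsmul, add_eq_zero_iff_eq_neg, Affine.Point.neg_some, Affine.Point.some.injEq,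
    Affine.negY, hW.a₁, hW.a₃]
  refine ⟨fun ⟨_, hy⟩ ↦ mul_left_cancel₀ two_ne_zero (by linear_combination hy), ?_⟩
  rintro rfl
  exact ⟨rfl, by ring⟩

theorem eq_of_two_nsmul_eq_zero (hW : IsSplit W e₁ e₂ e₃) {x y : L} (h : W.Nonsingular x y)
    (h2 : 2 • Affine.Point.some x y h = 0) : y = 0 ∧ (x = e₁ ∨ x = e₂ ∨ x = e₃) := by
  obtain rfl := (hW.two_nsmul_eq_zero_iff h).1 h2
  have heq := hW.equation_iff.1 h.1
  rw [zero_pow two_ne_zero, eq_comm, mul_eq_zero, mul_eq_zero] at heq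
  exact ⟨rfl, by simpa only [sub_eq_zero, or_assoc] using heq⟩

theorem two_nsmul_half (hW : IsSplit W e₁ e₂ e₃) (hr : IsHalving e₁ e₂ e₃ X Y r₁ r₂ r₃) {x y : L}
    (hx : x = X + r₁ * r₂ + r₁ * r₃ + r₂ * r₃) (hy : y = (r₁ + r₂) * (r₁ + r₃) * (r₂ + r₃))
    (h : W.Nonsingular x y) (hXY : W.Nonsingular X Y) :
    2 • Affine.Point.some x y h = .some X Y hXY := by
  obtain ⟨h12, h13, h23⟩ := hW.sum_ne_zero hr
  obtain ⟨h₁, h₂, h₃⟩ := hr.eq_sub_sq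
  have hneg : y - W.negY x y = 2 * y := by
    rw [Affine.negY, hW.a₁, hW.a₃]
    ring
  have hy0 : 2 * y ≠ 0 :=
    mul_ne_zero two_ne_zero (hy ▸ mul_ne_zero (mul_ne_zero h12 h13) h23)
  have hne : y ≠ W.negY x y := sub_ne_zero.1 (hneg ▸ hy0)
  have hslope : W.slope x x y y = r₁ + r₂ + r₃ := by
    rw [Affine.slope_of_Y_ne rfl hne, hneg, div_eq_iff hy0, hW.a₁, hW.a₂, hW.a₄, h₁, h₂, h₃, hx,
      hy]
    ring
  rw [two_nsmul, Affine.Point.add_self_of_Y_ne hne, Affine.Point.some.injEq, hslope]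
  simp only [Affine.addX, Affine.addY, Affine.negAddY, Affine.negY, hW.a₁, hW.a₂, hW.a₃,
    h₁, h₂, h₃, ← hr.mul_eq, hx, hy]
  constructor <;> ring

theorem eq_zero_or_eq_of_two_nsmul_eq_zero (hW : IsSplit W e₁ e₂ e₃) {P : W.Point}
    (hP : 2 • P = 0) :
    P = 0 ∨ P = .some e₁ 0 hW.nonsingular_left ∨ P = .some e₂ 0 hW.nonsingular_middle ∨
      P = .some e₁ 0 hW.nonsingular_left + .some e₂ 0 hW.nonsingular_middle := by
  set T₁ := Affine.Point.some e₁ 0 hW.nonsingular_left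
  set T₂ := Affine.Point.some e₂ 0 hW.nonsingular_middle
  have eq_third_point {Q : W.Point} (hQ : 2 • Q = 0) (h0 : Q ≠ 0) (h₁ : Q ≠ T₁) (h₂ : Q ≠ T₂) :
      ∃ h : W.Nonsingular e₃ 0, Q = .some e₃ 0 h := by
    rcases Q with _ | ⟨x, y, h⟩
    · exact absurd rfl h0
    obtain ⟨rfl, rfl | rfl | rfl⟩ := hW.eq_of_two_nsmul_eq_zero h hQ
    exacts [absurd rfl h₁, absurd rfl h₂, ⟨h, rfl⟩]
  have h2T₁ : 2 • T₁ = 0 := (hW.two_nsmul_eq_zero_iff _).2 rfl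
  have h2T₂ : 2 • T₂ = 0 := (hW.two_nsmul_eq_zero_iff _).2 rfl
  by_contra! ⟨h0, h₁, h₂, hadd⟩
  obtain ⟨h, rfl⟩ := eq_third_point hP h0 h₁ h₂
  have hne : T₁ + T₂ ≠ 0 := by
    rw [← h2T₂, two_nsmul, Ne, add_left_inj]
    exact fun h ↦ hW.ne₁₂ (Affine.Point.some.inj h).1
  obtain ⟨_, heq⟩ := eq_third_point (by rw [nsmul_add, h2T₁, h2T₂, add_zero]) hne
    (fun h ↦ Affine.Point.some_ne_zero _ (add_eq_left.1 h))
    (fun h ↦ Affine.Point.some_ne_zero _ (add_eq_right.1 h))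
  exact hadd heq.symm

end IsSplit

end Halving

section DivisionFields

open IntermediateField WeierstrassCurve

theorem mem_of_mul_nsmul_eq_zero {A : Type*} [AddCommGroup A] {H : AddSubgroup A} {m n : ℕ}
    (hn : ∀ P : A, n • P = 0 → P ∈ H) (hm : ∀ T : A, m • T = 0 → ∃ S ∈ H, n • S = T) {P : A}
    (hP : (m * n) • P = 0) : P ∈ H := by
  obtain ⟨S, hS, hST⟩ := hm (n • P) (by rwa [← mul_nsmul'])
  have hPS : P - S ∈ H := hn (P - S) (by rw [nsmul_sub, hST, sub_self])
  simpa only [sub_add_cancel] using add_mem hPS hS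

variable {F : Type*} [Field F] {E : WeierstrassCurve F}

open scoped Classical in
/-- The points of `E` over an algebraic closure of `F` with coordinates in `K`. -/
noncomputable def pointsOver (E : WeierstrassCurve F)
    (K : IntermediateField F (AlgebraicClosure F)) :
    AddSubgroup (E.baseChange (AlgebraicClosure F)).toAffine.Point :=
  (Affine.Point.map (W' := E.toAffine) K.val).range

variable {K : IntermediateField F (AlgebraicClosure F)}

open scoped Classical in
theorem some_mem_pointsOver_iff {x y : AlgebraicClosure F}
    (h : (E.baseChange (AlgebraicClosure F)).toAffine.Nonsingular x y) :
    Affine.Point.some x y h ∈ pointsOver E K ↔ x ∈ K ∧ y ∈ K := by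
  constructor
  · rintro ⟨_ | ⟨x', y', h'⟩, hP⟩
    · exact absurd hP.symm (Affine.Point.some_ne_zero h)
    · obtain ⟨rfl, rfl⟩ := Affine.Point.some.inj hP
      exact ⟨x'.2, y'.2⟩
  · rintro ⟨hx, hy⟩
    have hns := (Affine.baseChange_nonsingular E.toAffine K.val.injective ⟨x, hx⟩ ⟨y, hy⟩).1 h
    exact ⟨.some _ _ hns, rfl⟩

open scoped Classical in
theorem divisionField_le_iff {n : ℕ} : divisionField E n ≤ K ↔
    ∀ P : (E.baseChange (AlgebraicClosure F)).toAffine.Point, n • P = 0 → P ∈ pointsOver E K := by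
  rw [divisionField, adjoin_le_iff]
  constructor
  · rintro hK (_ | ⟨x, y, h⟩) hP
    · exact zero_mem _
    · exact (some_mem_pointsOver_iff h).2 ⟨hK ⟨x, y, h, hP, .inl rfl⟩, hK ⟨x, y, h, hP, .inr rfl⟩⟩
  · rintro hK z ⟨x, y, h, hP, rfl | rfl⟩
    · exact ((some_mem_pointsOver_iff h).1 (hK _ hP)).1
    · exact ((some_mem_pointsOver_iff h).1 (hK _ hP)).2

theorem divisionField_mono {m n : ℕ} (hmn : m ∣ n) : divisionField E m ≤ divisionField E n := by
  classical
  obtain ⟨k, rfl⟩ := hmn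
  refine divisionField_le_iff.2 fun P hP ↦ divisionField_le_iff.1 le_rfl P ?_
  rw [mul_nsmul, hP, nsmul_zero]

namespace IsSplit

variable {e₁ e₂ e₃ : AlgebraicClosure F} [NeZero (2 : AlgebraicClosure F)]

theorem divisionField_two_le_iff
    (hE : IsSplit (E.baseChange (AlgebraicClosure F)).toAffine e₁ e₂ e₃) :
    divisionField E 2 ≤ K ↔ e₁ ∈ K ∧ e₂ ∈ K ∧ e₃ ∈ K := by
  classical
  rw [divisionField_le_iff]
  constructor
  · intro h
    have root_mem {e : AlgebraicClosure F} (he : 0 = (e - e₁) * (e - e₂) * (e - e₃)) : e ∈ K := by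
      have hns := hE.nonsingular (y := 0) (by rw [zero_pow two_ne_zero, he])
      exact ((some_mem_pointsOver_iff hns).1 (h _ ((hE.two_nsmul_eq_zero_iff hns).2 rfl))).1
    exact ⟨root_mem (by ring), root_mem (by ring), root_mem (by ring)⟩
  · rintro ⟨h₁, h₂, h₃⟩ (_ | ⟨x, y, h⟩) hP
    · exact zero_mem _
    · refine (some_mem_pointsOver_iff h).2 ?_
      obtain ⟨rfl, rfl | rfl | rfl⟩ := hE.eq_of_two_nsmul_eq_zero h hP
      exacts [⟨h₁, zero_mem K⟩, ⟨h₂, zero_mem K⟩, ⟨h₃, zero_mem K⟩]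

theorem half_mem_pointsOver_iff
    (hE : IsSplit (E.baseChange (AlgebraicClosure F)).toAffine e₁ e₂ e₃)
    (hK : divisionField E 2 ≤ K) {X Y r₁ r₂ r₃ : AlgebraicClosure F}
    (hr : IsHalving e₁ e₂ e₃ X Y r₁ r₂ r₃) :
    Affine.Point.some _ _ (hE.nonsingular_half hr) ∈ pointsOver E K ↔
      r₁ ∈ K ∧ r₂ ∈ K ∧ r₃ ∈ K := by
  obtain ⟨h₁, h₂, h₃⟩ := hE.divisionField_two_le_iff.1 hK
  rw [some_mem_pointsOver_iff]
  refine ⟨fun ⟨hx, hy⟩ ↦ hE.sqrt_mem_of_half_mem hr h₁ h₂ h₃ hx hy, fun ⟨hr₁, hr₂, hr₃⟩ ↦ ?_⟩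
  have hX : X ∈ K := by
    rw [← sub_add_cancel X e₁, ← hr.sq₁]
    exact add_mem (pow_mem hr₁ 2) h₁
  exact ⟨add_mem (add_mem (add_mem hX (mul_mem hr₁ hr₂)) (mul_mem hr₁ hr₃)) (mul_mem hr₂ hr₃),
    mul_mem (mul_mem (add_mem hr₁ hr₂) (add_mem hr₁ hr₃)) (add_mem hr₂ hr₃)⟩

-- The multiples by `2 * m` of the two halves generate the `2`-torsion, so a point killed by `4 * m`
-- differs from a combination of the halves by a point killed by `2 * m`.
open scoped Classical in
theorem divisionField_four_mul_le_iff
    (hE : IsSplit (E.baseChange (AlgebraicClosure F)).toAffine e₁ e₂ e₃) {m : ℕ}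
    {X Y r₁ r₂ r₃ X' Y' s₁ s₂ s₃ : AlgebraicClosure F}
    {hP : (E.baseChange (AlgebraicClosure F)).toAffine.Nonsingular X Y}
    {hQ : (E.baseChange (AlgebraicClosure F)).toAffine.Nonsingular X' Y'}
    (hmP : m • Affine.Point.some X Y hP = .some e₁ 0 hE.nonsingular_left)
    (hmQ : m • Affine.Point.some X' Y' hQ = .some e₂ 0 hE.nonsingular_middle)
    (hr : IsHalving e₁ e₂ e₃ X Y r₁ r₂ r₃) (hs : IsHalving e₁ e₂ e₃ X' Y' s₁ s₂ s₃) :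
    divisionField E (4 * m) ≤ K ↔
      divisionField E (2 * m) ≤ K ∧ (r₁ ∈ K ∧ r₂ ∈ K ∧ r₃ ∈ K) ∧ (s₁ ∈ K ∧ s₂ ∈ K ∧ s₃ ∈ K) := by
  have h2 : divisionField E 2 ≤ divisionField E (2 * m) := divisionField_mono (dvd_mul_right 2 m)
  have h24 : divisionField E (2 * m) ≤ divisionField E (4 * m) :=
    divisionField_mono (mul_dvd_mul_right (by norm_num) m)
  set P := Affine.Point.some _ _ (hE.nonsingular_half hr)
  set Q := Affine.Point.some _ _ (hE.nonsingular_half hs)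
  have h2P : (2 * m) • P = .some e₁ 0 hE.nonsingular_left := by
    rw [mul_nsmul, hE.two_nsmul_half hr rfl rfl _ hP, hmP]
  have h2Q : (2 * m) • Q = .some e₂ 0 hE.nonsingular_middle := by
    rw [mul_nsmul, hE.two_nsmul_half hs rfl rfl _ hQ, hmQ]
  constructor
  · intro h
    have hK := h2.trans (h24.trans h)
    rw [← hE.half_mem_pointsOver_iff hK hr, ← hE.half_mem_pointsOver_iff hK hs]
    rw [divisionField_le_iff] at h
    have h4 : 4 * m = 2 * m * 2 := by ring
    refine ⟨h24.trans (divisionField_le_iff.2 h), h P ?_, h Q ?_⟩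
    · rw [h4, mul_nsmul, h2P, hE.two_nsmul_eq_zero_iff]
    · rw [h4, mul_nsmul, h2Q, hE.two_nsmul_eq_zero_iff]
  · rintro ⟨h, hrK, hsK⟩
    rw [← hE.half_mem_pointsOver_iff (h2.trans h) hr] at hrK
    rw [← hE.half_mem_pointsOver_iff (h2.trans h) hs] at hsK
    refine divisionField_le_iff.2 fun R hR ↦ mem_of_mul_nsmul_eq_zero (m := 2) (n := 2 * m)
      (divisionField_le_iff.1 h) (fun T hT ↦ ?_) (by rwa [← mul_assoc])
    rcases hE.eq_zero_or_eq_of_two_nsmul_eq_zero hT with rfl | rfl | rfl | rfl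
    exacts [⟨0, zero_mem _, nsmul_zero _⟩, ⟨P, hrK, h2P⟩, ⟨Q, hsK, h2Q⟩,
      ⟨P + Q, add_mem hrK hsK, by rw [nsmul_add, h2P, h2Q]⟩]

theorem divisionField_four_le_iff
    (hE : IsSplit (E.baseChange (AlgebraicClosure F)).toAffine e₁ e₂ e₃)
    {a₂ a₃ b₁ b₃ : AlgebraicClosure F} (ha : IsHalving e₁ e₂ e₃ e₁ 0 0 a₂ a₃)
    (hb : IsHalving e₁ e₂ e₃ e₂ 0 b₁ 0 b₃) :
    divisionField E 4 ≤ K ↔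
      divisionField E 2 ≤ K ∧ (a₂ ∈ K ∧ a₃ ∈ K) ∧ (b₁ ∈ K ∧ b₃ ∈ K) := by
  classical
  have h := hE.divisionField_four_mul_le_iff (K := K) (one_nsmul _) (one_nsmul _) ha hb
  simpa only [mul_one, zero_mem, true_and] using h

theorem divisionField_eight_le_iff
    (hE : IsSplit (E.baseChange (AlgebraicClosure F)).toAffine e₁ e₂ e₃)
    {a₂ a₃ b₁ b₃ x y r₁ r₂ r₃ x' y' s₁ s₂ s₃ : AlgebraicClosure F}
    (ha : IsHalving e₁ e₂ e₃ e₁ 0 0 a₂ a₃) (hb : IsHalving e₁ e₂ e₃ e₂ 0 b₁ 0 b₃)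
    (hx : x = e₁ + a₂ * a₃) (hy : y = a₂ * a₃ * (a₂ + a₃))
    (hx' : x' = e₂ + b₁ * b₃) (hy' : y' = b₁ * b₃ * (b₁ + b₃))
    (hr : IsHalving e₁ e₂ e₃ x y r₁ r₂ r₃) (hs : IsHalving e₁ e₂ e₃ x' y' s₁ s₂ s₃) :
    divisionField E 8 ≤ K ↔
      divisionField E 4 ≤ K ∧ (r₁ ∈ K ∧ r₂ ∈ K ∧ r₃ ∈ K) ∧ (s₁ ∈ K ∧ s₂ ∈ K ∧ s₃ ∈ K) := by
  classical
  have hxa : x = e₁ + 0 * a₂ + 0 * a₃ + a₂ * a₃ := by rw [hx]; ring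
  have hya : y = (0 + a₂) * (0 + a₃) * (a₂ + a₃) := by rw [hy]; ring
  have hxb : x' = e₂ + b₁ * 0 + b₁ * b₃ + 0 * b₃ := by rw [hx']; ring
  have hyb : y' = (b₁ + 0) * (b₁ + b₃) * (0 + b₃) := by rw [hy']; ring
  have hP : (E.baseChange (AlgebraicClosure F)).toAffine.Nonsingular x y := by
    rw [hxa, hya]
    exact hE.nonsingular_half ha
  have hQ : (E.baseChange (AlgebraicClosure F)).toAffine.Nonsingular x' y' := by
    rw [hxb, hyb]
    exact hE.nonsingular_half hb
  exact hE.divisionField_four_mul_le_iff (m := 2) (hE.two_nsmul_half ha hxa hya hP _)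
    (hE.two_nsmul_half hb hxb hyb hQ _) hr hs

end IsSplit

end DivisionFields

section TwistCurve

section Halvings

variable {L : Type*} [Field L] {d i s u w η ζ : L}

theorem isHalving_two_torsion_left (hw : w ^ 2 = 2) (hs : s ^ 2 = d) :
    IsHalving (2 * d) (d * (-1 - 2 * w)) (d * (-1 + 2 * w)) (2 * d) 0
      0 (s * (1 + w)) (s * (w - 1)) where
  sq₁ := by ring
  sq₂ := by linear_combination (1 + w) ^ 2 * hs + d * hw
  sq₃ := by linear_combination (w - 1) ^ 2 * hs + d * hw
  mul_eq := by ring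

theorem isHalving_two_torsion_middle (hi : i ^ 2 = -1) (hu : u ^ 8 = 2) (hs : s ^ 2 = d) :
    IsHalving (2 * d) (d * (-1 - 2 * u ^ 4)) (d * (-1 + 2 * u ^ 4)) (d * (-1 - 2 * u ^ 4)) 0
      (i * s * (1 + u ^ 4)) 0 (-(2 * i * s * u ^ 2)) where
  sq₁ := by linear_combination s ^ 2 * (1 + u ^ 4) ^ 2 * hi - (1 + u ^ 4) ^ 2 * hs - d * hu
  sq₂ := by ring
  sq₃ := by linear_combination 4 * s ^ 2 * u ^ 4 * hi - 4 * u ^ 4 * hs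
  mul_eq := by ring

theorem isHalving_four_torsion_left (hu : u ^ 8 = 2) (hs : s ^ 2 = d) (hη : η ^ 2 = 1 + u ^ 4) :
    IsHalving (2 * d) (d * (-1 - 2 * u ^ 4)) (d * (-1 + 2 * u ^ 4)) (3 * d) (2 * d * s * u ^ 4)
      s (s * u ^ 6 * η) (s * u ^ 6 * (u ^ 4 - 1) * η) where
  sq₁ := by linear_combination hs
  sq₂ := by
    linear_combination u ^ 12 * η ^ 2 * hs + d * u ^ 12 * hη + d * (u ^ 8 + u ^ 4 + 2) * hu
  sq₃ := by
    linear_combination u ^ 12 * (u ^ 4 - 1) ^ 2 * η ^ 2 * hs + d * u ^ 12 * (u ^ 4 - 1) ^ 2 * hη +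
      d * (u ^ 16 - u ^ 12 + u ^ 8 - u ^ 4 + 2) * hu
  mul_eq := by
    linear_combination s * u ^ 12 * (u ^ 4 - 1) * η ^ 2 * hs + d * s * u ^ 12 * (u ^ 4 - 1) * hη +
      d * s * u ^ 4 * (u ^ 8 + 1) * hu

theorem isHalving_four_torsion_middle (hi : i ^ 2 = -1) (hu : u ^ 8 = 2) (hs : s ^ 2 = d)
    (hη : η ^ 2 = 1 + u ^ 4) :
    IsHalving (2 * d) (d * (-1 - 2 * u ^ 4)) (d * (-1 + 2 * u ^ 4))
      (d * (-1 - 2 * u ^ 4) + 2 * d * u ^ 2 * (1 + u ^ 4))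
      (2 * d * i * s * u ^ 2 * (1 + u ^ 4) * (1 - u ^ 2) ^ 2)
      (i * s * (1 - u ^ 2) * η) (s * u ^ 5 * η) (s * (1 - u ^ 2) * u ^ 5) where
  sq₁ := by
    linear_combination (s * (1 - u ^ 2) * η) ^ 2 * hi - (1 - u ^ 2) ^ 2 * η ^ 2 * hs -
      d * (1 - u ^ 2) ^ 2 * hη - d * hu
  sq₂ := by linear_combination u ^ 10 * η ^ 2 * hs + d * u ^ 10 * hη + d * u ^ 2 * (1 + u ^ 4) * hu
  sq₃ := by
    linear_combination (1 - u ^ 2) ^ 2 * u ^ 10 * hs + d * u ^ 2 * (1 - u ^ 2) ^ 2 * hu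
  mul_eq := by
    linear_combination i * s * (1 - u ^ 2) ^ 2 * u ^ 10 * η ^ 2 * hs +
      d * i * s * (1 - u ^ 2) ^ 2 * u ^ 10 * hη +
      d * i * s * (1 - u ^ 2) ^ 2 * u ^ 2 * (1 + u ^ 4) * hu

theorem sq_eq_one_add [NeZero (2 : L)] (hi : i ^ 2 = -1) (hu : u ^ 8 = 2)
    (hζ : 2 * ζ ^ 2 = (1 + i) * u ^ 4) : (u ^ 2 * (u ^ 4 + 1 - i) / 2 * ζ) ^ 2 = 1 + u ^ 4 := by
  rw [div_mul_eq_mul_div, div_pow, div_eq_iff (pow_ne_zero 2 two_ne_zero)]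
  refine mul_left_cancel₀ two_ne_zero ?_
  linear_combination (u ^ 2 * (u ^ 4 + 1 - i)) ^ 2 * hζ + u ^ 8 * (i - 1 - 2 * u ^ 4) * hi +
    (u ^ 8 + 4 * u ^ 4 + 4 + i * u ^ 8) * hu

end Halvings

open IntermediateField

variable {F : Type*} [Field F] {E : WeierstrassCurve F} {d : ℤ}
  {K : IntermediateField F (AlgebraicClosure F)} {i s u w η ζ : AlgebraicClosure F}

/-- Over an algebraic closure of `F`, the curve `E` is
`y ^ 2 = (x - 2 * d) * (x - d * (-1 - 2 * w)) * (x - d * (-1 + 2 * w))`, with distinct roots.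
For `w ^ 2 = 2` the right-hand side is `x ^ 3 - 11 * d ^ 2 * x + 14 * d ^ 3`. -/
def IsSplitTwist (E : WeierstrassCurve F) (d : ℤ) (w : AlgebraicClosure F) : Prop :=
  IsSplit (E.baseChange (AlgebraicClosure F)).toAffine
    (2 * d) (d * (-1 - 2 * w)) (d * (-1 + 2 * w))

theorem one_add_ne_zero_of_sq_eq_two (hw : w ^ 2 = 2) : 1 + w ≠ 0 :=
  left_ne_zero_of_mul_eq_one (b := w - 1) (by linear_combination hw)

namespace IsSplitTwist

theorem cast_ne_zero (hE : IsSplitTwist E d w) : (d : AlgebraicClosure F) ≠ 0 := by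
  intro h
  exact hE.ne₁₂ (by rw [h, mul_zero, zero_mul])

theorem sqrt_ne_zero (hE : IsSplitTwist E d w) (hs : s ^ 2 = d) : s ≠ 0 := by
  rintro rfl
  rw [zero_pow two_ne_zero] at hs
  exact hE.cast_ne_zero hs.symm

variable [NeZero (2 : AlgebraicClosure F)]

theorem divisionField_two_le_iff (hE : IsSplitTwist E d w) :
    divisionField E 2 ≤ K ↔ w ∈ K := by
  have h2d : (2 * d : AlgebraicClosure F) ≠ 0 := mul_ne_zero two_ne_zero hE.cast_ne_zero
  have hdK : (d : AlgebraicClosure F) ∈ K := intCast_mem K d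
  have h2dK : (2 * d : AlgebraicClosure F) ∈ K := mul_mem (ofNat_mem K 2) hdK
  rw [IsSplit.divisionField_two_le_iff hE]
  constructor
  · rintro ⟨-, -, h⟩
    refine mem_of_mul_mem h2d h2dK ?_
    convert add_mem h hdK using 1
    ring
  · intro hwK
    have h2w : 2 * w ∈ K := mul_mem (ofNat_mem K 2) hwK
    have hneg : (-1 : AlgebraicClosure F) ∈ K := neg_mem (one_mem K)
    exact ⟨h2dK, mul_mem hdK (sub_mem hneg h2w), mul_mem hdK (add_mem hneg h2w)⟩

theorem divisionField_two (hE : IsSplitTwist E d w) :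
    divisionField E 2 = F⟮w⟯ :=
  eq_of_forall_ge_iff fun K ↦ by
    rw [hE.divisionField_two_le_iff, adjoin_simple_le_iff]

theorem divisionField_four_le_iff (hE : IsSplitTwist E d (u ^ 4)) (hi : i ^ 2 = -1) (hu : u ^ 8 = 2)
    (hs : s ^ 2 = d) :
    divisionField E 4 ≤ K ↔ i ∈ K ∧ u ^ 2 ∈ K ∧ s ∈ K := by
  have hw : (u ^ 4) ^ 2 = 2 := by rw [← hu, ← pow_mul]
  have hs0 := hE.sqrt_ne_zero hs
  rw [IsSplit.divisionField_four_le_iff hE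
    (isHalving_two_torsion_left hw hs) (isHalving_two_torsion_middle hi hu hs),
    hE.divisionField_two_le_iff, neg_mem_iff]
  constructor
  · rintro ⟨hwK, ⟨ha, -⟩, hb₁, hb₃⟩
    have h1wK : 1 + u ^ 4 ∈ K := add_mem (one_mem K) hwK
    have hsK : s ∈ K := mem_of_mul_mem (one_add_ne_zero_of_sq_eq_two hw) h1wK (by rwa [mul_comm])
    have hiK : i ∈ K :=
      mem_of_mul_mem (mul_ne_zero hs0 (one_add_ne_zero_of_sq_eq_two hw)) (mul_mem hsK h1wK)
        (by rwa [mul_comm, ← mul_assoc])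
    have hi0 : i ≠ 0 := by
      rintro rfl
      norm_num at hi
    exact ⟨hiK, mem_of_mul_mem (mul_ne_zero (mul_ne_zero two_ne_zero hi0) hs0)
      (mul_mem (mul_mem (ofNat_mem K 2) hiK) hsK) hb₃, hsK⟩
  · rintro ⟨hiK, htK, hsK⟩
    have hwK : u ^ 4 ∈ K := by
      rw [pow_mul u 2 2]
      exact pow_mem htK 2
    have h1wK : 1 + u ^ 4 ∈ K := add_mem (one_mem K) hwK
    exact ⟨hwK, ⟨mul_mem hsK h1wK, mul_mem hsK (sub_mem hwK (one_mem K))⟩,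
      mul_mem (mul_mem hiK hsK) h1wK, mul_mem (mul_mem (mul_mem (ofNat_mem K 2) hiK) hsK) htK⟩

theorem divisionField_four (hE : IsSplitTwist E d (u ^ 4)) (hi : i ^ 2 = -1) (hu : u ^ 8 = 2)
    (hs : s ^ 2 = d) : divisionField E 4 = F⟮i⟯ ⊔ F⟮u ^ 2⟯ ⊔ F⟮s⟯ :=
  eq_of_forall_ge_iff fun K ↦ by
    rw [hE.divisionField_four_le_iff hi hu hs, sup_le_iff, sup_le_iff,
      adjoin_simple_le_iff, adjoin_simple_le_iff, adjoin_simple_le_iff, and_assoc]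

theorem divisionField_eight_le_iff (hE : IsSplitTwist E d (u ^ 4)) (hi : i ^ 2 = -1)
    (hu : u ^ 8 = 2) (hs : s ^ 2 = d) (hη : η ^ 2 = 1 + u ^ 4) :
    divisionField E 8 ≤ K ↔ i ∈ K ∧ u ∈ K ∧ η ∈ K ∧ s ∈ K := by
  have hw : (u ^ 4) ^ 2 = 2 := by rw [← hu, ← pow_mul]
  have hs0 := hE.sqrt_ne_zero hs
  have hu0 : u ≠ 0 := by
    rintro rfl
    exact two_ne_zero (α := AlgebraicClosure F) (by rw [← hu, zero_pow (by norm_num)])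
  have h1t : 1 - u ^ 2 ≠ 0 :=
    left_ne_zero_of_mul_eq_one (b := -((1 + u ^ 2) * (1 + u ^ 4))) (by linear_combination hu)
  rw [IsSplit.divisionField_eight_le_iff hE
    (isHalving_two_torsion_left hw hs) (isHalving_two_torsion_middle hi hu hs)
    (by linear_combination -(u ^ 8 - 1) * hs - d * hu)
    (by linear_combination -(2 * s * u ^ 4 * (u ^ 8 - 1)) * hs - 2 * d * s * u ^ 4 * hu)
    (by linear_combination 2 * s ^ 2 * u ^ 2 * (1 + u ^ 4) * hi - 2 * u ^ 2 * (1 + u ^ 4) * hs)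
    (by linear_combination 2 * i * s ^ 3 * u ^ 2 * (1 + u ^ 4) * (1 - u ^ 2) ^ 2 * hi -
      2 * i * s * u ^ 2 * (1 + u ^ 4) * (1 - u ^ 2) ^ 2 * hs)
    (isHalving_four_torsion_left hu hs hη) (isHalving_four_torsion_middle hi hu hs hη),
    hE.divisionField_four_le_iff hi hu hs]
  constructor
  · rintro ⟨⟨hiK, htK, hsK⟩, ⟨-, hr₂, -⟩, -, -, hr₃⟩
    have hpow : ∀ n, u ^ (2 * n) ∈ K := fun n ↦ by
      rw [pow_mul]
      exact pow_mem htK n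
    have hηK : η ∈ K :=
      mem_of_mul_mem (mul_ne_zero hs0 (pow_ne_zero 6 hu0)) (mul_mem hsK (hpow 3)) hr₂
    have huK : u ∈ K := by
      refine mem_of_mul_mem (mul_ne_zero (mul_ne_zero hs0 h1t) (pow_ne_zero 4 hu0))
        (mul_mem (mul_mem hsK (sub_mem (one_mem K) htK)) (hpow 2)) ?_
      rwa [mul_assoc, ← pow_succ]
    exact ⟨hiK, huK, hηK, hsK⟩
  · rintro ⟨hiK, huK, hηK, hsK⟩
    have hpow : ∀ n, u ^ n ∈ K := pow_mem huK
    have h1t : 1 - u ^ 2 ∈ K := sub_mem (one_mem K) (hpow 2)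
    have hr : s * u ^ 6 ∈ K := mul_mem hsK (hpow 6)
    exact ⟨⟨hiK, hpow 2, hsK⟩,
      ⟨hsK, mul_mem hr hηK, mul_mem (mul_mem hr (sub_mem (hpow 4) (one_mem K))) hηK⟩,
      mul_mem (mul_mem (mul_mem hiK hsK) h1t) hηK, mul_mem (mul_mem hsK (hpow 5)) hηK,
      mul_mem (mul_mem hsK h1t) (hpow 5)⟩

theorem divisionField_eight (hE : IsSplitTwist E d (u ^ 4)) (hi : i ^ 2 = -1) (hu : u ^ 8 = 2)
    (hζ : 2 * ζ ^ 2 = (1 + i) * u ^ 4) (hs : s ^ 2 = d) :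
    divisionField E 8 = F⟮i⟯ ⊔ F⟮u⟯ ⊔ F⟮ζ⟯ ⊔ F⟮s⟯ := by
  set a := u ^ 2 * (u ^ 4 + 1 - i) / 2
  have hη : (a * ζ) ^ 2 = 1 + u ^ 4 := sq_eq_one_add hi hu hζ
  have ha0 : a ≠ 0 := by
    intro h
    refine one_add_ne_zero_of_sq_eq_two (w := u ^ 4) (by rw [← hu, ← pow_mul]) ?_
    rw [← hη, h, zero_mul, zero_pow two_ne_zero]
  refine eq_of_forall_ge_iff fun K ↦ ?_
  have ha_mem (hiK : i ∈ K) (huK : u ∈ K) : a ∈ K :=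
    div_mem (mul_mem (pow_mem huK 2) (sub_mem (add_mem (pow_mem huK 4) (one_mem K)) hiK))
      (ofNat_mem K 2)
  rw [hE.divisionField_eight_le_iff hi hu hs hη]
  simp only [sup_le_iff, adjoin_simple_le_iff, and_assoc]
  exact and_congr_right fun hiK ↦ and_congr_right fun huK ↦ and_congr_left fun _ ↦
    ⟨mem_of_mul_mem ha0 (ha_mem hiK huK), mul_mem (ha_mem hiK huK)⟩

end IsSplitTwist

end TwistCurve

section Degrees

open IntermediateField

variable {d : ℤ}

theorem finrank_adjoin_sqrt_two {L : Type*} [Field L] [CharZero L] {w : L} (hw : w ^ 2 = 2) :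
    Module.finrank ℚ ℚ⟮w⟯ = 2 := by
  have hmem : w ∉ (⊥ : IntermediateField ℚ L) := by
    intro h
    obtain ⟨a, rfl⟩ := exists_ratCast_of_mem_bot h
    have ha : a ^ 2 = 2 * 1 ^ 2 := by exact_mod_cast hw
    exact one_ne_zero (eq_zero_of_sq_eq_two_mul_sq ha)
  have := finrank_sup_adjoin_sqrt (by rw [hw]; exact ofNat_mem _ 2) hmem
  rwa [bot_sup_eq, IntermediateField.finrank_bot] at this

theorem finrank_sup_adjoin_sqrt_squarefree {L : Type*} [Field L] [CharZero L] {i u ζ s : L}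
    (hi : i ^ 2 = -1) (hu : u ^ 8 = 2) (hζ : 2 * ζ ^ 2 = (1 + i) * u ^ 4) (hd : Squarefree d)
    (hs : s ^ 2 = d) {K : IntermediateField ℚ L} (hK : ℚ⟮i⟯ ⊔ ℚ⟮u ^ 4⟯ ≤ K)
    (hK' : K ≤ ℚ⟮i⟯ ⊔ ℚ⟮u⟯ ⊔ ℚ⟮ζ⟯) :
    (Module.finrank ℚ ↥(K ⊔ ℚ⟮s⟯) = Module.finrank ℚ K ↔ d ∈ ({1, -1, 2, -2} : Set ℤ)) ∧
      (d ∉ ({1, -1, 2, -2} : Set ℤ) →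
        Module.finrank ℚ ↥(K ⊔ ℚ⟮s⟯) = 2 * Module.finrank ℚ K) := by
  have hsK : s ∈ K ↔ d ∈ ({1, -1, 2, -2} : Set ℤ) :=
    ⟨fun h ↦ mem_pm_one_pm_two_of_sqrt_mem hi hu hζ hd hs (hK' h),
      fun h ↦ hK (sqrt_mem_of_mem_pm_one_pm_two hi (by rw [← hu, ← pow_mul]) h hs)⟩
  have hs2 : s ^ 2 ∈ K := hs ▸ intCast_mem K d
  have : FiniteDimensional ℚ ↥(ℚ⟮i⟯ ⊔ ℚ⟮u⟯ ⊔ ℚ⟮ζ⟯) := Module.finite_of_finrank_pos (by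
    rw [finrank_sup_adjoin_zeta hi hu hζ]
    norm_num)
  have : FiniteDimensional ℚ K := Module.Finite.of_injective
    (IntermediateField.inclusion hK').toLinearMap (IntermediateField.inclusion hK').injective
  rw [← hsK]
  exact ⟨finrank_sup_adjoin_sqrt_eq_iff hs2, finrank_sup_adjoin_sqrt hs2⟩

theorem finrank_sup_adjoin_fourthRoot_sup_adjoin_sqrt {L : Type*} [Field L] [CharZero L]
    {i u ζ s : L} (hi : i ^ 2 = -1) (hu : u ^ 8 = 2) (hζ : 2 * ζ ^ 2 = (1 + i) * u ^ 4)
    (hd : Squarefree d) (hs : s ^ 2 = d) :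
    (Module.finrank ℚ ↥(ℚ⟮i⟯ ⊔ ℚ⟮u ^ 2⟯ ⊔ ℚ⟮s⟯) = 8 ↔ d ∈ ({1, -1, 2, -2} : Set ℤ)) ∧
      (d ∉ ({1, -1, 2, -2} : Set ℤ) →
        Module.finrank ℚ ↥(ℚ⟮i⟯ ⊔ ℚ⟮u ^ 2⟯ ⊔ ℚ⟮s⟯) = 16) := by
  have h4 : Module.finrank ℚ ↥(ℚ⟮i⟯ ⊔ ℚ⟮u ^ 2⟯) = 8 :=
    finrank_adjoin_sqrt_neg_one_sup_adjoin (n := 1) hi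
      (show (u ^ 2) ^ 4 = 2 by rw [← hu, ← pow_mul])
  have hle : ℚ⟮i⟯ ⊔ ℚ⟮u ^ 4⟯ ≤ ℚ⟮i⟯ ⊔ ℚ⟮u ^ 2⟯ := by
    rw [pow_mul u 2 2]
    exact sup_adjoin_pow_le _ _ 2
  have := finrank_sup_adjoin_sqrt_squarefree hi hu hζ hd hs hle
    ((sup_adjoin_pow_le _ u 2).trans le_sup_left)
  rwa [h4] at this

theorem finrank_sup_adjoin_zeta_sup_adjoin_sqrt {L : Type*} [Field L] [CharZero L]
    {i u ζ s : L} (hi : i ^ 2 = -1) (hu : u ^ 8 = 2) (hζ : 2 * ζ ^ 2 = (1 + i) * u ^ 4)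
    (hd : Squarefree d) (hs : s ^ 2 = d) :
    (Module.finrank ℚ ↥(ℚ⟮i⟯ ⊔ ℚ⟮u⟯ ⊔ ℚ⟮ζ⟯ ⊔ ℚ⟮s⟯) = 32 ↔ d ∈ ({1, -1, 2, -2} : Set ℤ)) ∧
      (d ∉ ({1, -1, 2, -2} : Set ℤ) →
        Module.finrank ℚ ↥(ℚ⟮i⟯ ⊔ ℚ⟮u⟯ ⊔ ℚ⟮ζ⟯ ⊔ ℚ⟮s⟯) = 64) := by
  have := finrank_sup_adjoin_sqrt_squarefree hi hu hζ hd hs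
    ((sup_adjoin_pow_le _ u 4).trans le_sup_left) le_rfl
  rwa [finrank_sup_adjoin_zeta hi hu hζ] at this

theorem adjoin_pair_eq_sup {F L : Type*} [Field F] [Field L] [Algebra F L] (a b : L) :
    adjoin F {a, b} = F⟮a⟯ ⊔ F⟮b⟯ := by
  rw [Set.insert_eq, adjoin_union]

theorem isGalois_algebraicClosure_rat : IsGalois ℚ (AlgebraicClosure ℚ) :=
  @IsAlgClosure.isGalois ℚ (AlgebraicClosure ℚ) _ _ (AlgebraicClosure.instAlgebra ℚ) _ _

theorem isSplitTwist_twistCurve {w : AlgebraicClosure ℚ} (hd : d ≠ 0) (hw : w ^ 2 = 2) :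
    IsSplitTwist (twistCurve d) d w := by
  have hd' : (d : AlgebraicClosure ℚ) ≠ 0 := Int.cast_ne_zero.2 hd
  constructor
  · simp only [twistCurve, WeierstrassCurve.Affine.baseChange_a₁, eq_ratCast, Rat.cast_zero]
  · simp only [twistCurve, WeierstrassCurve.Affine.baseChange_a₂, eq_ratCast, Rat.cast_zero]
    ring
  · simp only [twistCurve, WeierstrassCurve.Affine.baseChange_a₃, eq_ratCast, Rat.cast_zero]
  · simp only [twistCurve, WeierstrassCurve.Affine.baseChange_a₄, eq_ratCast, Rat.cast_neg,
      Rat.cast_mul, Rat.cast_ofNat, Rat.cast_pow, Rat.cast_intCast]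
    linear_combination 4 * (d : AlgebraicClosure ℚ) ^ 2 * hw
  · simp only [twistCurve, WeierstrassCurve.Affine.baseChange_a₆, eq_ratCast, Rat.cast_mul,
      Rat.cast_ofNat, Rat.cast_pow, Rat.cast_intCast]
    linear_combination -8 * (d : AlgebraicClosure ℚ) ^ 3 * hw
  · intro h
    have h0 : 3 + 2 * w = 0 := mul_left_cancel₀ hd' (by linear_combination h)
    exact one_ne_zero (α := AlgebraicClosure ℚ) (by linear_combination (3 - 2 * w) * h0 + 4 * hw)
  · intro h
    have h0 : 3 - 2 * w = 0 := mul_left_cancel₀ hd' (by linear_combination h)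
    exact one_ne_zero (α := AlgebraicClosure ℚ) (by linear_combination (3 + 2 * w) * h0 + 4 * hw)
  · intro h
    have h0 : w = 0 := mul_left_cancel₀ hd' (by linear_combination -h / 4)
    exact two_ne_zero (α := AlgebraicClosure ℚ) (by linear_combination w * h0 - hw)

variable {i s u w ζ : AlgebraicClosure ℚ}

theorem divisionField_twistCurve_two (hd : d ≠ 0) (hw : w ^ 2 = 2) :
    divisionField (twistCurve d) 2 = ℚ⟮w⟯ :=
  (isSplitTwist_twistCurve hd hw).divisionField_two

theorem divisionField_twistCurve_four (hd : d ≠ 0) (hi : i ^ 2 = -1) (hu : u ^ 8 = 2)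
    (hs : s ^ 2 = d) : divisionField (twistCurve d) 4 = ℚ⟮i⟯ ⊔ ℚ⟮u ^ 2⟯ ⊔ ℚ⟮s⟯ :=
  (isSplitTwist_twistCurve hd (by rw [← hu, ← pow_mul])).divisionField_four hi hu hs

theorem divisionField_twistCurve_eight (hd : d ≠ 0) (hi : i ^ 2 = -1) (hu : u ^ 8 = 2)
    (hζ : 2 * ζ ^ 2 = (1 + i) * u ^ 4) (hs : s ^ 2 = d) :
    divisionField (twistCurve d) 8 = ℚ⟮i⟯ ⊔ ℚ⟮u⟯ ⊔ ℚ⟮ζ⟯ ⊔ ℚ⟮s⟯ :=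
  (isSplitTwist_twistCurve hd (by rw [← hu, ← pow_mul])).divisionField_eight hi hu hζ hs

theorem exists_sqrt_neg_one_eighthRoot_zeta (k : Type*) [Field k] [IsAlgClosed k]
    [NeZero (2 : k)] :
    ∃ i u ζ : k, i ^ 2 = -1 ∧ u ^ 8 = 2 ∧ 2 * ζ ^ 2 = (1 + i) * u ^ 4 := by
  obtain ⟨i, hi⟩ := IsAlgClosed.exists_pow_nat_eq (-1 : k) two_pos
  obtain ⟨u, hu⟩ := IsAlgClosed.exists_pow_nat_eq (2 : k) (n := 8) (by norm_num)
  obtain ⟨ζ, hζ⟩ := IsAlgClosed.exists_pow_nat_eq ((1 + i) * u ^ 4 / 2) two_pos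
  exact ⟨i, u, ζ, hi, hu, by rw [hζ, mul_div_cancel₀ _ two_ne_zero]⟩

theorem finrank_divisionField_twistCurve_two (hd : d ≠ 0) :
    Module.finrank ℚ (divisionField (twistCurve d) 2) = 2 := by
  obtain ⟨w, hw⟩ := IsAlgClosed.exists_pow_nat_eq (2 : AlgebraicClosure ℚ) two_pos
  rw [divisionField_twistCurve_two hd hw]
  exact finrank_adjoin_sqrt_two hw

theorem finrank_divisionField_twistCurve_four (hd : Squarefree d) :
    (Module.finrank ℚ (divisionField (twistCurve d) 4) = 8 ↔ d ∈ ({1, -1, 2, -2} : Set ℤ)) ∧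
      (d ∉ ({1, -1, 2, -2} : Set ℤ) →
        Module.finrank ℚ (divisionField (twistCurve d) 4) = 16) := by
  obtain ⟨i, u, ζ, hi, hu, hζ⟩ := exists_sqrt_neg_one_eighthRoot_zeta (AlgebraicClosure ℚ)
  obtain ⟨s, hs⟩ := IsAlgClosed.exists_pow_nat_eq (d : AlgebraicClosure ℚ) two_pos
  rw [divisionField_twistCurve_four hd.ne_zero hi hu hs]
  exact finrank_sup_adjoin_fourthRoot_sup_adjoin_sqrt hi hu hζ hd hs

theorem finrank_divisionField_twistCurve_eight (hd : Squarefree d) :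
    (Module.finrank ℚ (divisionField (twistCurve d) 8) = 32 ↔ d ∈ ({1, -1, 2, -2} : Set ℤ)) ∧
      (d ∉ ({1, -1, 2, -2} : Set ℤ) →
        Module.finrank ℚ (divisionField (twistCurve d) 8) = 64) := by
  obtain ⟨i, u, ζ, hi, hu, hζ⟩ := exists_sqrt_neg_one_eighthRoot_zeta (AlgebraicClosure ℚ)
  obtain ⟨s, hs⟩ := IsAlgClosed.exists_pow_nat_eq (d : AlgebraicClosure ℚ) two_pos
  rw [divisionField_twistCurve_eight hd.ne_zero hi hu hζ hs]
  exact finrank_sup_adjoin_zeta_sup_adjoin_sqrt hi hu hζ hd hs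

theorem finrank_adjoin_of_aeval_polyFour_eq_zero {α : AlgebraicClosure ℚ}
    (hα : aeval α polyFour = 0) : Module.finrank ℚ ℚ⟮α⟯ = 8 := by
  obtain ⟨i, hi⟩ := IsAlgClosed.exists_pow_nat_eq (-1 : AlgebraicClosure ℚ) two_pos
  obtain ⟨t, ht⟩ := IsAlgClosed.exists_pow_nat_eq (2 : AlgebraicClosure ℚ) four_pos
  rw [← adjoin_eq_of_aeval_polyFour_eq_zero hi ht hα]
  exact finrank_adjoin_sqrt_neg_one_sup_adjoin (n := 1) hi ht

theorem divisionField_twistCurve_four_eq_adjoin (hd : d ≠ 0) {α : AlgebraicClosure ℚ}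
    (hα : aeval α polyFour = 0) (hs : s ^ 2 = d) :
    divisionField (twistCurve d) 4 = adjoin ℚ {α, s} := by
  obtain ⟨i, u, -, hi, hu, -⟩ := exists_sqrt_neg_one_eighthRoot_zeta (AlgebraicClosure ℚ)
  rw [divisionField_twistCurve_four hd hi hu hs, adjoin_pair_eq_sup,
    adjoin_eq_of_aeval_polyFour_eq_zero (t := u ^ 2) hi (by rw [← hu, ← pow_mul]) hα]

theorem finrank_adjoin_of_aeval_polyEight_eq_zero {β : AlgebraicClosure ℚ}
    (hβ : aeval β polyEight = 0) : Module.finrank ℚ ℚ⟮β⟯ = 32 := by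
  obtain ⟨i, u, ζ, hi, hu, hζ⟩ := exists_sqrt_neg_one_eighthRoot_zeta (AlgebraicClosure ℚ)
  have := isGalois_algebraicClosure_rat
  rw [← adjoin_eq_of_aeval_polyEight_eq_zero hi hu hζ hβ, finrank_sup_adjoin_zeta hi hu hζ]

theorem divisionField_twistCurve_eight_eq_adjoin (hd : d ≠ 0) {β : AlgebraicClosure ℚ}
    (hβ : aeval β polyEight = 0) (hs : s ^ 2 = d) :
    divisionField (twistCurve d) 8 = adjoin ℚ {β, s} := by
  obtain ⟨i, u, ζ, hi, hu, hζ⟩ := exists_sqrt_neg_one_eighthRoot_zeta (AlgebraicClosure ℚ)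
  have := isGalois_algebraicClosure_rat
  rw [divisionField_twistCurve_eight hd hi hu hζ hs, adjoin_pair_eq_sup,
    adjoin_eq_of_aeval_polyEight_eq_zero hi hu hζ hβ]

end Degrees

theorem mainTheorem8 (d : ℤ) (hd : Squarefree d) :
    -- the `2`-division field is `ℚ(√2)`
    (∀ r : AlgebraicClosure ℚ, r ^ 2 = 2 →
      divisionField (twistCurve d) 2 = IntermediateField.adjoin ℚ {r}) ∧
    -- the `4`-division field is `ℚ(α, √d)`, with `ℚ(α)` of degree `8`
    (∀ α : AlgebraicClosure ℚ, aeval α polyFour = 0 →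
      Module.finrank ℚ (IntermediateField.adjoin ℚ {α}) = 8 ∧
      ∀ s : AlgebraicClosure ℚ, s ^ 2 = (d : AlgebraicClosure ℚ) →
        divisionField (twistCurve d) 4 = IntermediateField.adjoin ℚ {α, s}) ∧
    -- the `8`-division field is `ℚ(β, √d)`, with `ℚ(β)` of degree `32`
    (∀ β : AlgebraicClosure ℚ, aeval β polyEight = 0 →
      Module.finrank ℚ (IntermediateField.adjoin ℚ {β}) = 32 ∧
      ∀ s : AlgebraicClosure ℚ, s ^ 2 = (d : AlgebraicClosure ℚ) →
        divisionField (twistCurve d) 8 = IntermediateField.adjoin ℚ {β, s}) ∧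
    -- the degrees
    Module.finrank ℚ (divisionField (twistCurve d) 2) = 2 ∧
    (Module.finrank ℚ (divisionField (twistCurve d) 4) = 8 ↔ d ∈ ({1, -1, 2, -2} : Set ℤ)) ∧
    (Module.finrank ℚ (divisionField (twistCurve d) 8) = 32 ↔ d ∈ ({1, -1, 2, -2} : Set ℤ)) ∧
    (d ∉ ({1, -1, 2, -2} : Set ℤ) →
      Module.finrank ℚ (divisionField (twistCurve d) 4) = 16 ∧
      Module.finrank ℚ (divisionField (twistCurve d) 8) = 64) := by
  exact ⟨fun r hr ↦ divisionField_twistCurve_two hd.ne_zero hr,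
    fun α hα ↦ ⟨finrank_adjoin_of_aeval_polyFour_eq_zero hα,
      fun s hs ↦ divisionField_twistCurve_four_eq_adjoin hd.ne_zero hα hs⟩,
    fun β hβ ↦ ⟨finrank_adjoin_of_aeval_polyEight_eq_zero hβ,
      fun s hs ↦ divisionField_twistCurve_eight_eq_adjoin hd.ne_zero hβ hs⟩,
    finrank_divisionField_twistCurve_two hd.ne_zero,
    (finrank_divisionField_twistCurve_four hd).1,
    (finrank_divisionField_twistCurve_eight hd).1,
    fun h ↦ ⟨(finrank_divisionField_twistCurve_four hd).2 h,
      (finrank_divisionField_twistCurve_eight hd).2 h⟩⟩
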